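/- Let $a>b>0$ and let $g:[0,\infty)\to[0,\infty)$ be continuous with $g(0)=0$ and $g(x)>0$ for $x>0$. Suppose that there is $\delta_1>0$ such that $g\in C^1(0,\delta_1)$ with $g'>0$ on $(0,\delta_1)$, and that there is $\beta>1$ such that $g'$ is regularly varying at $0$ with exponent $\beta-1$, i.e. $\lim_{t\to0^+} g'(ct)/g'(t)=c^{\beta-1}$ for every $c>0$. Put $G(x)=\int_x^1 \frac{du}{g(u)}$ for $x>0$, and let $G^{-1}$ be its inverse. Let $\tau:[0,\infty)\to[0,\infty)$ be continuous with $\lim_{t\to\infty}(t-\tau(t))=\infty$, put $-\bar\tau=\inf_{t\ge0}(t-\tau(t))$, and let $\psi:[-\bar\tau,0]\to(0,\infty)$ be continuous. Let $\sigma$ be a non-negative continuous function on $[-\bar\tau,\infty)$, with $1/\sigma$ integrable on $[0,t]$ for every $t\ge 0$, such that $$\lim_{t\to\infty}\int_0^t\frac{ds}{\sigma(s)}=\infty,\qquad \lim_{t\to\infty}\sigma(t)=\infty,\qquad \lim_{t\to\infty}\int_{t-\tau(t)}^t\frac{ds}{\sigma(s)}=1,$$ and suppose that $\lim_{t\to\infty}\sigma(t)/t=\lambda$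 for some $\lambda\in[0,\infty]$. Let $x$ be a continuous function on $[-\bar\tau,\infty)$ with $x=\psi$ on $[-\bar\tau,0]$ which solves either the delay equation $$x'(t)=-ag(x(t))+bg(x(t-\tau(t))),\quad t\ge 0,$$ or the equation with maximum functional $$x'(t)=-ag(x(t))+b\sup_{t-\tau(t)\le s\le t}g(x(s)),\quad t\ge 0,$$ and suppose that $x(t)\to0$ as $t\to\infty$. Then, in either case: (i) If $\lambda=0$, then $\displaystyle\lim_{t\to\infty}\frac{x(t)}{G^{-1}(t)}=(a-b)^{-1/(\beta-1)}$. (ii) If $0<\lambda<\frac{\beta-1}{\beta}\log(a/b)$, and $$\Lambda=\Bigl(a-b\Bigl(\frac1{1-q}\Bigr)^{\beta/(\beta-1)}\Bigr)^{-1/(\beta-1)},\qquad q=1-e^{-\lambda},$$ then $$\Lambda\le\liminf_{t\to\infty}\frac{x(t)}{G^{-1}(t)}\le\limsup_{t\to\infty}\frac{x(t)}{G^{-1}(t)}<\infty.$$ (iii) If $\frac{\beta-1}{\beta}\log(a/b)<\lambda<\infty$, then $\displaystyle\lim_{t\to\infty}\frac{\log x(t)}{\log t}=-\frac1\beta\,\frac1\lambda\log\Bigl(\frac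 ab\Bigr)$. (iv) If $\lambda=\infty$, then $\displaystyle\lim_{t\to\infty}\frac{\log x(t)}{\int_0^t\frac{ds}{\sigma(s)}}=-\frac1\beta\log\Bigl(\frac ab\Bigr)$. -/

import Mathlib

open Filter Topology Set
open scoped ENNReal

namespace DelayDecay

/-- `f` is regularly varying at zero with exponent `α`. -/
def RegVaryAtZero (f : ℝ → ℝ) (α : ℝ) : Prop :=
  ∀ c : ℝ, 0 < c → Tendsto (fun t => f (c * t) / f t) (𝓝[>] 0) (𝓝 (c ^ α))

/-- The conditions on the nonlinearity `g : [0, ∞) → [0, ∞)` (only its values on `[0, ∞)` matter):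
`g` is continuous, `g 0 = 0`, `g > 0` on `(0, ∞)`, and near `0` it is `C¹` with a positive derivative
which is regularly varying at `0` with exponent `β - 1`, where `β > 1`. -/
structure Nonlinearity (g : ℝ → ℝ) (β : ℝ) : Prop where
  cont : ContinuousOn g (Ici 0)
  map_zero : g 0 = 0
  pos : ∀ x, 0 < x → 0 < g x
  smooth : ∃ δ₁ : ℝ, 0 < δ₁ ∧ ContDiffOn ℝ 1 g (Ioo 0 δ₁) ∧ ∀ x ∈ Ioo 0 δ₁, 0 < deriv g x
  one_lt : 1 < β
  regVary : RegVaryAtZero (deriv g) (β - 1)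

/-- The conditions on the delay: `τ` is continuous and non-negative on `[0, ∞)`,
`inf_{t ≥ 0} (t - τ t) = -τbar` is finite, and `t - τ t → ∞`. -/
structure Delay (τ : ℝ → ℝ) (τbar : ℝ) : Prop where
  cont : ContinuousOn τ (Ici 0)
  nonneg : ∀ t, 0 ≤ t → 0 ≤ τ t
  isGLB : IsGLB ((fun t => t - τ t) '' Ici 0) (-τbar)
  tendsto : Tendsto (fun t => t - τ t) atTop atTop

/-- The conditions on the auxiliary function `σ` on `[-τbar, ∞)`. A non-integrable function has
integral `0` here, so `integral_atTop` contains the integrability of `1 / σ` on every `[0, t]`. -/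
structure Auxiliary (τ σ : ℝ → ℝ) (τbar : ℝ) : Prop where
  cont : ContinuousOn σ (Ici (-τbar))
  nonneg : ∀ t, -τbar ≤ t → 0 ≤ σ t
  integral_atTop : Tendsto (fun t => ∫ s in (0 : ℝ)..t, 1 / σ s) atTop atTop
  tendsto : Tendsto σ atTop atTop
  integral_delay : Tendsto (fun t => ∫ s in (t - τ t)..t, 1 / σ s) atTop (𝓝 1)

/-- `ψ` is a continuous function from `[-τbar, 0]` to `(0, ∞)`. -/
def InitialFunction (τbar : ℝ) (ψ : ℝ → ℝ) : Prop :=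
  ContinuousOn ψ (Icc (-τbar) 0) ∧ ∀ t ∈ Icc (-τbar) 0, 0 < ψ t

/-- `x` is continuous on `[-τbar, ∞)`, satisfies `x' = -a g(x) + F` on `[0, ∞)` (with the one-sided
derivative at `0`) and `x = ψ` on `[-τbar, 0]`. -/
structure SolvesWithForcing (a : ℝ) (g : ℝ → ℝ) (τbar : ℝ) (ψ F x : ℝ → ℝ) : Prop where
  cont : ContinuousOn x (Ici (-τbar))
  hasDeriv : ∀ t, 0 ≤ t → HasDerivWithinAt x (-a * g (x t) + F t) (Ici 0) t
  initial : ∀ t ∈ Icc (-τbar) 0, x t = ψ t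

/-- Solutions of `x'(t) = -a g(x(t)) + b g(x(t - τ(t)))`, `t ≥ 0`, with `x = ψ` on `[-τbar, 0]`. -/
def SolvesDelay (a b : ℝ) (g τ : ℝ → ℝ) (τbar : ℝ) (ψ x : ℝ → ℝ) : Prop :=
  SolvesWithForcing a g τbar ψ (fun t => b * g (x (t - τ t))) x

/-- Solutions of `x'(t) = -a g(x(t)) + b sup_{t - τ(t) ≤ s ≤ t} g(x(s))`, `t ≥ 0`, with `x = ψ` on
`[-τbar, 0]`. -/
def SolvesMax (a b : ℝ) (g τ : ℝ → ℝ) (τbar : ℝ) (ψ x : ℝ → ℝ) : Prop :=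
  SolvesWithForcing a g τbar ψ
    (fun t => b * sSup ((fun s => g (x s)) '' Icc (t - τ t) t)) x

/-- `G(x) = ∫_x^1 du / g(u)`, `x > 0`. -/
noncomputable def G (g : ℝ → ℝ) (x : ℝ) : ℝ := ∫ u in x..1, 1 / g u

/-- The inverse of `G : (0, ∞) → ℝ`. -/
noncomputable def Ginv (g : ℝ → ℝ) : ℝ → ℝ := Function.invFunOn (G g) (Ioi 0)

/-- `Λ = (a - b (1 / (1 - q)) ^ (β / (β - 1))) ^ (-1 / (β - 1))`. -/
noncomputable def Lam (a b β q : ℝ) : ℝ :=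
  (a - b * (1 / (1 - q)) ^ (β / (β - 1))) ^ (-1 / (β - 1))

/-- The asymptotic behaviour of `x` in the four regimes of `lam = lim σ(t) / t ∈ [0, ∞]`.
In (ii), `q = 1 - exp (-lam)`. The lower and upper limits are taken in the extended reals. -/
def Regimes (a b β : ℝ) (g σ : ℝ → ℝ) (lam : ℝ≥0∞) (x : ℝ → ℝ) : Prop :=
  (lam = 0 →
    Tendsto (fun t => x t / Ginv g t) atTop (𝓝 ((a - b) ^ (-1 / (β - 1))))) ∧
  (0 < lam → lam < ENNReal.ofReal ((β - 1) / β * Real.log (a / b)) →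
    ((Lam a b β (1 - Real.exp (-lam.toReal)) : ℝ) : EReal)
        ≤ liminf (fun t => ((x t / Ginv g t : ℝ) : EReal)) atTop ∧
      liminf (fun t => ((x t / Ginv g t : ℝ) : EReal)) atTop
        ≤ limsup (fun t => ((x t / Ginv g t : ℝ) : EReal)) atTop ∧
      limsup (fun t => ((x t / Ginv g t : ℝ) : EReal)) atTop < ⊤) ∧
  (ENNReal.ofReal ((β - 1) / β * Real.log (a / b)) < lam → lam < ⊤ →
    Tendsto (fun t => Real.log (x t) / Real.log t) atTop
      (𝓝 (-(1 / β) * (1 / lam.toReal) * Real.log (a / b)))) ∧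
  (lam = ⊤ →
    Tendsto (fun t => Real.log (x t) / ∫ s in (0 : ℝ)..t, 1 / σ s) atTop
      (𝓝 (-(1 / β) * Real.log (a / b))))

end DelayDecay

/-!
Both equations imply, for their positive solutions, the differential inequalities
`-a g(x(t)) + b g(x(t - τ(t))) ≤ x'(t) ≤ -a g(x(t)) + b max_{[t - τ(t), t]} g(x)`
(`DelayInequalities`), and everything is derived from these by comparison with explicit functions `u`
(`DelayInequalities.lt_of_supersolution`, `DelayInequalities.lt_of_subsolution`): one looks at the first
contact of `x` and `u`.

Write `y` for `Ginv g`, so that `y' = -g(y)`. Integrating the limit relation for `g'` shows that `g` is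
regularly varying at zero with exponent `β`, and integrating once more that `G` is regularly varying
with exponent `1 - β`. As `g`, `G` and `y` are monotone near the relevant end points, pointwise
limits suffice: `y(r v) / y(v) → r ^ (-1 / (β - 1))` and `g(y(r v)) / g(y(v)) → r ^ (-β / (β - 1))`, with
no uniform convergence theorem.

Let `λ` be the limit of `σ(t) / t`. When it is finite, `t - τ(t) ~ exp(-λ) t`. The function
`u = y ∘ φ` satisfies `u' = -φ' g(u)`, so it is a strict supersolution as long as
`φ' < a - b g(u(t - τ(t))) / g(u(t))`, where the last quotient is close to `exp(λ β / (β - 1))` if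
`φ(t - τ(t)) / φ(t)` is close to `exp(-λ)`; subsolutions are similar. Hence the critical speed of `φ` is
`κ = a - b exp(λ β / (β - 1))`, which is positive exactly below the threshold for `λ`. The solution may
be far from `y(κ t)` at the time where the asymptotic relations become effective, so `φ` has to join an
arbitrary initial value to the line `c t` while changing slowly: `c / φ(t) = 1 / t + A t ^ (-1 - θ)` for
the upper estimate (`DelayInequalities.le_Ginv`) and `φ(t) = c t + A t ^ (1 - θ)` for the lower one
(`DelayInequalities.Ginv_le`), with `θ` small and `A` free. Letting `c → κ` gives
`x / y → κ ^ (-1 / (β - 1))`. For `λ = 0` this is the first regime; in the second regime the limit is `Λ`,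
so there the lower and the upper limit even coincide.

Above the threshold `u = C exp(-ν S)` is used, where `S(t) = ∫_0^t 1 / σ`. Since
`S(t) - S(t - τ(t)) → 1`, the quotient `g(u(t - τ(t))) / g(u(t))` tends to `exp(β ν)`, and
`u' = -ν u / σ` has a favourable sign for a subsolution and is negligible against `g(u)` for a
supersolution. The critical value is therefore `ν = log(a / b) / β`
(`DelayInequalities.tendsto_log_div_integral`), and `S(t) ~ log t / λ` if `λ` is finite.
-/

namespace DelayDecay

variable {g : ℝ → ℝ} {β : ℝ}

/-! ### Regular variation of the nonlinearity -/

theorem Nonlinearity.exists_deriv (hg : Nonlinearity g β) :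
    ∃ δ : ℝ, 0 < δ ∧ ∀ x ∈ Ioo 0 δ, HasDerivAt g (deriv g x) x ∧ 0 < deriv g x := by
  obtain ⟨δ, hδ, hs, hd⟩ := hg.smooth
  refine ⟨δ, hδ, fun x hx => ⟨?_, hd x hx⟩⟩
  exact ((hs.differentiableOn one_ne_zero).differentiableAt (isOpen_Ioo.mem_nhds hx)).hasDerivAt

theorem Nonlinearity.exists_strictMonoOn (hg : Nonlinearity g β) :
    ∃ δ : ℝ, 0 < δ ∧ StrictMonoOn g (Icc 0 δ) := by
  obtain ⟨δ, hδ, h⟩ := hg.exists_deriv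
  refine ⟨δ, hδ, strictMonoOn_of_deriv_pos (convex_Icc _ _)
    (hg.cont.mono Icc_subset_Ici_self) fun x hx => ?_⟩
  rw [interior_Icc] at hx
  exact (h x hx).2

/-- `g` is regularly varying at zero with exponent `β`; upper half. For small `u` one has
`c g'(c u) ≤ K g'(u)`, and this may be integrated from zero, where both sides of the claim vanish. -/
theorem Nonlinearity.comp_mul_le (hg : Nonlinearity g β) {c K : ℝ} (hc : 0 < c)
    (hK : c ^ β < K) : ∀ᶠ x in 𝓝[>] 0, g (c * x) ≤ K * g x := by
  obtain ⟨δ, hδ, hd⟩ := hg.exists_deriv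
  have h1 : ∀ᶠ u in 𝓝[>] (0 : ℝ), deriv g (c * u) / deriv g u < K / c := by
    refine (hg.regVary c hc).eventually_lt_const ?_
    rw [Real.rpow_sub_one hc.ne']
    gcongr
  obtain ⟨d, hd0, hd1⟩ := mem_nhdsGT_iff_exists_Ioo_subset.1 h1
  set e := min d (min δ (δ / c)) with he
  have he0 : 0 < e := lt_min hd0 (lt_min hδ (by positivity))
  have hin : ∀ u ∈ Ioo 0 e, u ∈ Ioo 0 d ∧ u ∈ Ioo 0 δ ∧ c * u ∈ Ioo 0 δ := by
    intro u hu
    refine ⟨⟨hu.1, hu.2.trans_le (min_le_left _ _)⟩,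
      ⟨hu.1, hu.2.trans_le ((min_le_right _ _).trans (min_le_left _ _))⟩, mul_pos hc hu.1, ?_⟩
    have := hu.2.trans_le ((min_le_right _ _).trans (min_le_right _ _))
    rwa [lt_div_iff₀ hc, mul_comm] at this
  have hD : ∀ u ∈ Ioo 0 e, HasDerivAt (fun x => K * g x - g (c * x))
      (K * deriv g u - deriv g (c * u) * (c * 1)) u := by
    intro u hu
    obtain ⟨-, h2, h3⟩ := hin u hu
    have h4 : HasDerivAt (fun x => c * x) (c * 1) u := (hasDerivAt_id u).const_mul c
    exact ((hd u h2).1.const_mul K).sub (HasDerivAt.comp u (hd _ h3).1 h4)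
  have hmono : MonotoneOn (fun x => K * g x - g (c * x)) (Icc 0 e) := by
    refine monotoneOn_of_deriv_nonneg (convex_Icc _ _) ?_ ?_ ?_
    · refine (continuousOn_const.mul (hg.cont.mono Icc_subset_Ici_self)).sub
        (hg.cont.comp (by fun_prop) fun u hu => ?_)
      exact mul_nonneg hc.le hu.1
    · rw [interior_Icc]
      exact fun u hu => (hD u hu).differentiableAt.differentiableWithinAt
    · rw [interior_Icc]
      intro u hu
      rw [(hD u hu).deriv]
      obtain ⟨h2, h3, -⟩ := hin u hu
      have h4 : deriv g (c * u) / deriv g u < K / c := hd1 h2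
      rw [div_lt_div_iff₀ (hd u h3).2 hc] at h4
      linarith
  filter_upwards [Ioo_mem_nhdsGT he0] with x hx
  have := hmono (left_mem_Icc.2 he0.le) (Ioo_subset_Icc_self hx) hx.1.le
  simp only [mul_zero, hg.map_zero, sub_zero] at this
  linarith

theorem tendsto_const_mul_nhdsGT_zero {c : ℝ} (hc : 0 < c) :
    Tendsto (fun x => c * x) (𝓝[>] 0) (𝓝[>] 0) := by
  refine tendsto_nhdsWithin_iff.2 ⟨?_, ?_⟩
  · have : Tendsto (fun x : ℝ => c * x) (𝓝 0) (𝓝 (c * 0)) := (continuous_const_mul c).tendsto 0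
    rw [mul_zero] at this
    exact this.mono_left nhdsWithin_le_nhds
  · filter_upwards [self_mem_nhdsWithin] with x hx using mul_pos hc hx

theorem Nonlinearity.le_comp_mul (hg : Nonlinearity g β) {c K : ℝ} (hc : 0 < c)
    (hK : K < c ^ β) : ∀ᶠ x in 𝓝[>] 0, K * g x ≤ g (c * x) := by
  rcases le_or_gt K 0 with h0 | h0
  · filter_upwards [self_mem_nhdsWithin] with x hx
    exact (mul_nonpos_of_nonpos_of_nonneg h0 (hg.pos x hx).le).trans
      (hg.pos _ (mul_pos hc hx)).le
  have hc' : 0 < c⁻¹ := inv_pos.2 hc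
  have h1 : c⁻¹ ^ β < K⁻¹ := by
    rw [Real.inv_rpow hc.le]
    exact (inv_lt_inv₀ (by positivity) h0).2 hK
  filter_upwards [(tendsto_const_mul_nhdsGT_zero hc).eventually (hg.comp_mul_le hc' h1)] with x hx
  rw [inv_mul_cancel_left₀ hc.ne'] at hx
  rwa [← le_inv_mul_iff₀ h0]

/-- A positive continuous function `p` with `p x ≤ p (x / 2)` for small `x` is bounded below by a
positive constant near zero: follow the doubling orbit of `x` to a fixed compact interval. -/
theorem exists_pos_le_of_le_half {p : ℝ → ℝ} (hp : ContinuousOn p (Ioi 0)) (hpos : ∀ x, 0 < x → 0 < p x)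
    (h : ∀ᶠ x in 𝓝[>] 0, p x ≤ p (x / 2)) :
    ∃ k > 0, ∀ᶠ x in 𝓝[>] 0, k ≤ p x := by
  obtain ⟨d, hd0, hd⟩ := mem_nhdsGT_iff_exists_Ioc_subset.1 h
  have hd0 : 0 < d := hd0
  obtain ⟨z, hz, hz'⟩ := (isCompact_Icc (a := d / 2) (b := d)).exists_isMinOn
    (nonempty_Icc.2 (by linarith))
    (hp.mono fun x hx => lt_of_lt_of_le (by positivity : (0:ℝ) < d / 2) hx.1)
  have hz0 : 0 < z := lt_of_lt_of_le (by positivity) hz.1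
  refine ⟨p z, hpos z hz0, ?_⟩
  have key : ∀ n : ℕ, ∀ x ∈ Ioc (0 : ℝ) d, d < x * 2 ^ n → p z ≤ p x := by
    intro n
    induction n with
    | zero => intro x hx h; simp at h; exact absurd h (not_lt.2 hx.2)
    | succ n ih =>
      intro x hx hn
      rcases le_or_gt (d / 2) x with h2 | h2
      · exact hz' ⟨h2, hx.2⟩
      · have h3 : 2 * x ∈ Ioc 0 d := ⟨by linarith [hx.1], by linarith⟩
        have h4 := ih (2 * x) h3 (by rw [pow_succ] at hn; linarith)
        have h5 : p (2 * x) ≤ p (2 * x / 2) := hd h3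
        rw [mul_div_cancel_left₀ x two_ne_zero] at h5
        exact h4.trans h5
  filter_upwards [Ioc_mem_nhdsGT hd0] with x hx
  obtain ⟨n, hn⟩ := pow_unbounded_of_one_lt (d / x) (one_lt_two)
  refine key n x hx ?_
  rwa [div_lt_iff₀ hx.1, mul_comm] at hn

/-- A lower bound of Potter type: regular variation with exponent `β` gives `g x ≥ k x ^ γ` near zero for
every `γ > β`. -/
theorem Nonlinearity.exists_rpow_le (hg : Nonlinearity g β) {γ : ℝ} (hγ : β < γ) :
    ∃ k > 0, ∀ᶠ x in 𝓝[>] 0, k * x ^ γ ≤ g x := by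
  have hc : ContinuousOn (fun x => g x / x ^ γ) (Ioi 0) := by
    refine (hg.cont.mono Ioi_subset_Ici_self).div
      (fun x hx => (Real.continuousAt_rpow_const x γ (Or.inl (ne_of_gt hx))).continuousWithinAt)
      fun x hx => (Real.rpow_pos_of_pos hx _).ne'
  have hhalf : ∀ᶠ x in 𝓝[>] 0, g x / x ^ γ ≤ g (x / 2) / (x / 2) ^ γ := by
    have h1 : (2⁻¹ : ℝ) ^ γ < 2⁻¹ ^ β :=
      Real.rpow_lt_rpow_of_exponent_gt (by norm_num) (by norm_num) hγ
    filter_upwards [hg.le_comp_mul (by norm_num) h1, self_mem_nhdsWithin] with x hx h0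
    have h0 : 0 < x := h0
    rw [show x / 2 = 2⁻¹ * x by ring, Real.mul_rpow (by norm_num) h0.le, ← div_div]
    gcongr
    rw [le_div_iff₀ (by positivity)]
    linarith
  obtain ⟨k, hk, h⟩ := exists_pos_le_of_le_half hc
    (fun x hx => div_pos (hg.pos x hx) (Real.rpow_pos_of_pos hx _)) hhalf
  refine ⟨k, hk, ?_⟩
  filter_upwards [h, self_mem_nhdsWithin] with x hx h0
  rwa [le_div_iff₀ (Real.rpow_pos_of_pos h0 _)] at hx

/-- Since `β > 1`, `g` is at most linear near zero; this makes `∫ 1 / g` diverge there. -/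
theorem Nonlinearity.exists_le_mul (hg : Nonlinearity g β) :
    ∃ K > 0, ∀ᶠ x in 𝓝[>] 0, g x ≤ K * x := by
  have hc : ContinuousOn (fun x => x / g x) (Ioi 0) :=
    continuousOn_id.div (hg.cont.mono Ioi_subset_Ici_self) fun x hx => (hg.pos x hx).ne'
  have hhalf : ∀ᶠ x in 𝓝[>] 0, x / g x ≤ x / 2 / g (x / 2) := by
    have h1 : (2⁻¹ : ℝ) ^ β < 2⁻¹ := by
      simpa using Real.rpow_lt_rpow_of_exponent_gt (x := (2⁻¹ : ℝ)) (by norm_num) (by norm_num)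
        hg.one_lt
    filter_upwards [hg.comp_mul_le (by norm_num) h1, self_mem_nhdsWithin] with x hx h0
    have h0 : 0 < x := h0
    have h2 : 0 < g (x / 2) := hg.pos _ (by positivity)
    rw [show 2⁻¹ * x = x / 2 by ring] at hx
    rw [div_le_div_iff₀ (hg.pos x h0) h2]
    nlinarith
  obtain ⟨k, hk, h⟩ :=
    exists_pos_le_of_le_half hc (fun x hx => div_pos hx (hg.pos x hx)) hhalf
  refine ⟨k⁻¹, inv_pos.2 hk, ?_⟩
  filter_upwards [h, self_mem_nhdsWithin] with x hx h0
  rw [le_div_iff₀ (hg.pos x h0)] at hx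
  rwa [le_inv_mul_iff₀ hk]

/-! ### The function `G` and its inverse -/

theorem Nonlinearity.hasDerivAt_G (hg : Nonlinearity g β) {x : ℝ} (hx : 0 < x) :
    HasDerivAt (G g) (-(1 / g x)) x := by
  have hc : ContinuousOn (fun u => 1 / g u) (Ioi 0) :=
    continuousOn_const.div (hg.cont.mono Ioi_subset_Ici_self) fun u hu => (hg.pos u hu).ne'
  refine intervalIntegral.integral_hasDerivAt_left ?_ ?_ (hc.continuousAt (Ioi_mem_nhds hx))
  · refine (hc.mono fun u hu => ?_).intervalIntegrable
    exact (lt_min hx one_pos).trans_le hu.1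
  · exact hc.stronglyMeasurableAtFilter isOpen_Ioi x hx

theorem Nonlinearity.strictAntiOn_G (hg : Nonlinearity g β) : StrictAntiOn (G g) (Ioi 0) := by
  refine strictAntiOn_of_deriv_neg (convex_Ioi 0)
    (fun x hx => (hg.hasDerivAt_G hx).continuousAt.continuousWithinAt) fun x hx => ?_
  rw [interior_Ioi] at hx
  rw [(hg.hasDerivAt_G hx).deriv, neg_lt_zero]
  exact one_div_pos.2 (hg.pos x hx)

theorem Nonlinearity.tendsto_G (hg : Nonlinearity g β) : Tendsto (G g) (𝓝[>] 0) atTop := by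
  obtain ⟨K, hK, h⟩ := hg.exists_le_mul
  obtain ⟨d, hd0, hd⟩ := mem_nhdsGT_iff_exists_Ioo_subset.1 h
  have hd0 : 0 < d := hd0
  have hD : ∀ x ∈ Ioo 0 d, HasDerivAt (fun x => G g x + K⁻¹ * Real.log x)
      (-(1 / g x) + K⁻¹ * x⁻¹) x := fun x hx =>
    (hg.hasDerivAt_G hx.1).add ((Real.hasDerivAt_log hx.1.ne').const_mul _)
  have hanti : AntitoneOn (fun x => G g x + K⁻¹ * Real.log x) (Ioo 0 d) := by
    refine antitoneOn_of_deriv_nonpos (convex_Ioo 0 d)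
      (fun x hx => (hD x hx).continuousAt.continuousWithinAt) ?_ ?_
    · rw [interior_Ioo]
      exact fun x hx => (hD x hx).differentiableAt.differentiableWithinAt
    · rw [interior_Ioo]
      intro x hx
      have h1 : g x ≤ K * x := hd hx
      have h2 : 1 / (K * x) ≤ 1 / g x := one_div_le_one_div_of_le (hg.pos x hx.1) h1
      rw [(hD x hx).deriv, ← mul_inv, ← one_div]
      linarith
  have hlog : Tendsto (fun x => G g (d / 2) + K⁻¹ * Real.log (d / 2) + K⁻¹ * -Real.log x)
      (𝓝[>] 0) atTop :=
    tendsto_atTop_add_const_left _ _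
      ((tendsto_neg_atBot_atTop.comp Real.tendsto_log_nhdsGT_zero).const_mul_atTop (inv_pos.2 hK))
  refine tendsto_atTop_mono' _ ?_ hlog
  filter_upwards [Ioo_mem_nhdsGT (show (0 : ℝ) < d / 2 by positivity)] with x hx
  have := hanti ⟨hx.1, by linarith [hx.2]⟩ (⟨by linarith, by linarith⟩ : d / 2 ∈ Ioo 0 d) hx.2.le
  simp only at this
  linarith

/-- `G` is regularly varying at zero with exponent `1 - β`; upper half. The derivatives satisfy
`k / g (k x) ≤ r' / g x` with `r' < r`, and the constant of integration is absorbed because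
`G` is unbounded. -/
theorem Nonlinearity.G_comp_mul_le (hg : Nonlinearity g β) {k r : ℝ} (hk : 0 < k)
    (hr : k ^ (1 - β) < r) : ∀ᶠ x in 𝓝[>] 0, G g (k * x) ≤ r * G g x := by
  obtain ⟨r', h1, h2⟩ := exists_between hr
  have hr' : 0 < r' := (Real.rpow_pos_of_pos hk _).trans h1
  have h3 : k / r' < k ^ β := by
    rw [Real.rpow_sub hk, Real.rpow_one, div_lt_iff₀ (by positivity)] at h1
    rwa [div_lt_iff₀ hr', mul_comm]
  obtain ⟨d, hd0, hd⟩ := mem_nhdsGT_iff_exists_Ioo_subset.1 (hg.le_comp_mul hk h3)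
  have hd0 : 0 < d := hd0
  have hD : ∀ x ∈ Ioo 0 d, HasDerivAt (fun x => r' * G g x - G g (k * x))
      (r' * -(1 / g x) - -(1 / g (k * x)) * (k * 1)) x := fun x hx =>
    ((hg.hasDerivAt_G hx.1).const_mul _).sub (HasDerivAt.comp x
      (hg.hasDerivAt_G (mul_pos hk hx.1)) ((hasDerivAt_id x).const_mul k))
  have hanti : AntitoneOn (fun x => r' * G g x - G g (k * x)) (Ioo 0 d) := by
    refine antitoneOn_of_deriv_nonpos (convex_Ioo 0 d)
      (fun x hx => (hD x hx).continuousAt.continuousWithinAt) ?_ ?_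
    · rw [interior_Ioo]
      exact fun x hx => (hD x hx).differentiableAt.differentiableWithinAt
    · rw [interior_Ioo]
      intro x hx
      have h4 : k / r' * g x ≤ g (k * x) := hd hx
      have h5 : k / g (k * x) ≤ r' / g x := by
        rw [div_le_div_iff₀ (hg.pos _ (mul_pos hk hx.1)) (hg.pos x hx.1)]
        rw [div_mul_eq_mul_div, div_le_iff₀ hr'] at h4
        linarith
      rw [(hD x hx).deriv]
      rw [div_eq_mul_one_div] at h5
      rw [div_eq_mul_one_div r'] at h5
      linarith
  have hG := (hg.tendsto_G.const_mul_atTop (sub_pos.2 h2)).eventually_ge_atTop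
    (-(r' * G g (d / 2) - G g (k * (d / 2))))
  filter_upwards [Ioo_mem_nhdsGT (show (0 : ℝ) < d / 2 by positivity), hG] with x hx hG
  have := hanti ⟨hx.1, by linarith [hx.2]⟩ (⟨by linarith, by linarith⟩ : d / 2 ∈ Ioo 0 d) hx.2.le
  simp only at this
  linarith

theorem Nonlinearity.le_G_comp_mul (hg : Nonlinearity g β) {k r : ℝ} (hk : 0 < k) (hr0 : 0 < r)
    (hr : r < k ^ (1 - β)) : ∀ᶠ x in 𝓝[>] 0, r * G g x ≤ G g (k * x) := by
  have h1 : k⁻¹ ^ (1 - β) < r⁻¹ := by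
    rw [Real.inv_rpow hk.le]
    exact (inv_lt_inv₀ (by positivity) hr0).2 hr
  filter_upwards [(tendsto_const_mul_nhdsGT_zero hk).eventually
    (hg.G_comp_mul_le (inv_pos.2 hk) h1)] with x hx
  rw [inv_mul_cancel_left₀ hk.ne'] at hx
  rwa [← le_inv_mul_iff₀ hr0]

theorem Nonlinearity.Ginv_spec (hg : Nonlinearity g β) {t : ℝ} (ht : 0 ≤ t) :
    0 < Ginv g t ∧ G g (Ginv g t) = t := by
  have h : t ∈ G g '' Ioi 0 := by
    have h1 : ∀ᶠ x in 𝓝[>] (0 : ℝ), t ≤ G g x := hg.tendsto_G.eventually_ge_atTop t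
    obtain ⟨x, hx, hx0, hx1⟩ := (h1.and (Ioo_mem_nhdsGT (zero_lt_one (α := ℝ)))).exists
    have h2 : G g 1 = 0 := by simp [G]
    have hc : ContinuousOn (G g) (Icc x 1) := fun z hz =>
      (hg.hasDerivAt_G (hx0.trans_le hz.1)).continuousAt.continuousWithinAt
    obtain ⟨z, hz, hzt⟩ := intermediate_value_Icc' hx1.le hc (show t ∈ Icc (G g 1) (G g x) from
      ⟨by rw [h2]; exact ht, hx⟩)
    exact ⟨z, hx0.trans_le hz.1, hzt⟩
  exact ⟨Function.invFunOn_mem h, Function.invFunOn_eq h⟩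

theorem Nonlinearity.Ginv_pos (hg : Nonlinearity g β) {t : ℝ} (ht : 0 ≤ t) : 0 < Ginv g t :=
  (hg.Ginv_spec ht).1

theorem Nonlinearity.Ginv_le_iff (hg : Nonlinearity g β) {t x : ℝ} (ht : 0 ≤ t) (hx : 0 < x) :
    Ginv g t ≤ x ↔ G g x ≤ t := by
  rw [← hg.strictAntiOn_G.le_iff_ge hx (hg.Ginv_pos ht), (hg.Ginv_spec ht).2]

theorem Nonlinearity.le_Ginv_iff (hg : Nonlinearity g β) {t x : ℝ} (ht : 0 ≤ t) (hx : 0 < x) :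
    x ≤ Ginv g t ↔ t ≤ G g x := by
  rw [← hg.strictAntiOn_G.le_iff_ge (hg.Ginv_pos ht) hx, (hg.Ginv_spec ht).2]

theorem Nonlinearity.strictAntiOn_Ginv (hg : Nonlinearity g β) :
    StrictAntiOn (Ginv g) (Ici 0) := by
  intro s hs t ht hst
  rw [← not_le, hg.le_Ginv_iff ht (hg.Ginv_pos hs), (hg.Ginv_spec hs).2, not_le]
  exact hst

theorem Nonlinearity.tendsto_Ginv (hg : Nonlinearity g β) :
    Tendsto (Ginv g) atTop (𝓝[>] 0) := by
  refine tendsto_nhdsWithin_iff.2 ⟨tendsto_order.2 ⟨fun c hc => ?_, fun c hc => ?_⟩, ?_⟩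
  · filter_upwards [eventually_ge_atTop 0] with t ht using hc.trans (hg.Ginv_pos ht)
  · filter_upwards [eventually_ge_atTop 0, eventually_gt_atTop (G g c)] with t ht h
    rwa [← not_le, hg.le_Ginv_iff ht hc, not_le]
  · filter_upwards [eventually_ge_atTop 0] with t ht using hg.Ginv_pos ht

theorem Nonlinearity.hasDerivAt_Ginv (hg : Nonlinearity g β) {t : ℝ} (ht : 0 < t) :
    HasDerivAt (Ginv g) (-g (Ginv g t)) t := by
  have hy := hg.Ginv_pos ht.le
  have hc : ContinuousAt (Ginv g) t := by
    have h1 : Ioo (-Ginv g 0) 0 ⊆ (fun s => -Ginv g s) '' Ioi 0 := by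
      intro x hx
      have hx0 : 0 < -x := neg_pos.2 hx.2
      have h2 : 0 < G g (-x) := by
        have := hg.strictAntiOn_G hx0 (hg.Ginv_pos le_rfl) (neg_lt.1 hx.1)
        rwa [(hg.Ginv_spec le_rfl).2] at this
      have h3 : Ginv g (G g (-x)) = -x :=
        hg.strictAntiOn_G.injOn (hg.Ginv_pos h2.le) hx0 (hg.Ginv_spec h2.le).2
      exact ⟨G g (-x), h2, by simp only [h3, neg_neg]⟩
    have h4 : StrictMonoOn (fun s => -Ginv g s) (Ioi 0) := fun a ha b hb hab =>
      neg_lt_neg (hg.strictAntiOn_Ginv (mem_Ici.2 (le_of_lt ha)) (mem_Ici.2 (le_of_lt hb)) hab)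
    have h5 : (fun s => -Ginv g s) '' Ioi 0 ∈ 𝓝 (-Ginv g t) := mem_of_superset
      (Ioo_mem_nhds (neg_lt_neg (hg.strictAntiOn_Ginv self_mem_Ici ht.le ht)) (neg_neg_of_pos hy)) h1
    exact (h4.continuousAt_of_image_mem_nhds (Ioi_mem_nhds ht) h5).neg.congr
      (Eventually.of_forall fun s => neg_neg _)
  have hd := (hg.hasDerivAt_G hy).of_local_left_inverse hc
    (neg_ne_zero.2 (one_div_pos.2 (hg.pos _ hy)).ne') (by
      filter_upwards [Ioi_mem_nhds ht] with s hs using (hg.Ginv_spec (le_of_lt hs)).2)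
  simpa using hd

theorem Nonlinearity.Ginv_le_mul (hg : Nonlinearity g β) {k r : ℝ} (hk : 0 < k)
    (hr : k ^ (1 - β) < r) :
    ∀ᶠ v in atTop, ∀ w, r * v ≤ w → Ginv g w ≤ k * Ginv g v := by
  have hr0 : 0 < r := (Real.rpow_pos_of_pos hk _).trans hr
  filter_upwards [hg.tendsto_Ginv.eventually (hg.G_comp_mul_le hk hr), eventually_ge_atTop 0]
    with v hv hv0 w hw
  have hy := hg.Ginv_spec hv0
  rw [hy.2] at hv
  rw [hg.Ginv_le_iff ((mul_nonneg hr0.le hv0).trans hw) (mul_pos hk hy.1)]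
  exact hv.trans hw

theorem Nonlinearity.mul_le_Ginv (hg : Nonlinearity g β) {k r : ℝ} (hk : 0 < k) (hr0 : 0 < r)
    (hr : r < k ^ (1 - β)) :
    ∀ᶠ v in atTop, ∀ w, 0 ≤ w → w ≤ r * v → k * Ginv g v ≤ Ginv g w := by
  filter_upwards [hg.tendsto_Ginv.eventually (hg.le_G_comp_mul hk hr0 hr), eventually_ge_atTop 0]
    with v hv hv0 w hw0 hw
  have hy := hg.Ginv_spec hv0
  rw [hy.2] at hv
  rw [hg.le_Ginv_iff hw0 (mul_pos hk hy.1)]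
  exact hw.trans hv

/-- Upper half of `g (Ginv (r v)) / g (Ginv v) → r ^ (-β / (β - 1))` as `v → ∞`, in the form used
for comparison: the argument `w` only has to lie above `r v`. -/
theorem Nonlinearity.g_Ginv_le_mul (hg : Nonlinearity g β) {M r : ℝ} (hr : 0 < r)
    (hM : r ^ (-(β / (β - 1))) < M) :
    ∀ᶠ v in atTop, ∀ w, r * v ≤ w → g (Ginv g w) ≤ M * g (Ginv g v) := by
  have hβ := hg.one_lt
  have hβ1 : 0 < β - 1 := sub_pos.2 hβ
  have hβ0 : 0 < β := by linarith
  obtain ⟨M', h1, h2⟩ := exists_between hM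
  have hM' : 0 < M' := (Real.rpow_pos_of_pos hr _).trans h1
  set k := M' ^ (1 / β) with hk
  have hk0 : 0 < k := Real.rpow_pos_of_pos hM' _
  have hkβ : k ^ β < M := by
    rwa [hk, ← Real.rpow_mul hM'.le, one_div_mul_cancel hβ0.ne', Real.rpow_one]
  have hkr : k ^ (1 - β) < r := by
    have := Real.rpow_lt_rpow_of_neg (Real.rpow_pos_of_pos hr _) h1
      (show 1 / β * (1 - β) < 0 from mul_neg_of_pos_of_neg (by positivity) (by linarith))
    rw [← Real.rpow_mul hr.le, show -(β / (β - 1)) * (1 / β * (1 - β)) = 1 by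
      field_simp; ring, Real.rpow_one] at this
    rwa [hk, ← Real.rpow_mul hM'.le]
  obtain ⟨δ, hδ, hmono⟩ := hg.exists_strictMonoOn
  have hsmall := ((tendsto_const_mul_nhdsGT_zero hk0).comp hg.tendsto_Ginv).eventually
    (Ioo_mem_nhdsGT hδ)
  filter_upwards [hg.Ginv_le_mul hk0 hkr, hg.tendsto_Ginv.eventually (hg.comp_mul_le hk0 hkβ),
    hsmall, eventually_ge_atTop 0] with v hv hv2 hv3 hv0 w hw
  have hw' := hv w hw
  have hy := hg.Ginv_pos ((mul_nonneg hr.le hv0).trans hw)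
  exact (hmono.monotoneOn ⟨hy.le, hw'.trans hv3.2.le⟩ (Ioo_subset_Icc_self hv3) hw').trans hv2

/-- Lower half of `g (Ginv (r v)) / g (Ginv v) → r ^ (-β / (β - 1))`; here `w` has to be large as well, so
that `Ginv w` lies in the range where `g` increases. -/
theorem Nonlinearity.mul_le_g_Ginv (hg : Nonlinearity g β) {M r : ℝ} (hr : 0 < r) (hM0 : 0 < M)
    (hM : M < r ^ (-(β / (β - 1)))) :
    ∃ V : ℝ, 0 < V ∧ ∀ v w, V ≤ v → V ≤ w → w ≤ r * v → M * g (Ginv g v) ≤ g (Ginv g w) := by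
  have hβ := hg.one_lt
  have hβ1 : 0 < β - 1 := sub_pos.2 hβ
  have hβ0 : 0 < β := by linarith
  obtain ⟨M', h1, h2⟩ := exists_between hM
  have hM' : 0 < M' := hM0.trans h1
  set k := M' ^ (1 / β) with hk
  have hk0 : 0 < k := Real.rpow_pos_of_pos hM' _
  have hkβ : M < k ^ β := by
    rwa [hk, ← Real.rpow_mul hM'.le, one_div_mul_cancel hβ0.ne', Real.rpow_one]
  have hkr : r < k ^ (1 - β) := by
    have := Real.rpow_lt_rpow_of_neg hM' h2
      (show 1 / β * (1 - β) < 0 from mul_neg_of_pos_of_neg (by positivity) (by linarith))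
    rw [← Real.rpow_mul hr.le, show -(β / (β - 1)) * (1 / β * (1 - β)) = 1 by
      field_simp; ring, Real.rpow_one] at this
    rwa [hk, ← Real.rpow_mul hM'.le]
  obtain ⟨δ, hδ, hmono⟩ := hg.exists_strictMonoOn
  have hsmall := hg.tendsto_Ginv.eventually (Ioo_mem_nhdsGT hδ)
  obtain ⟨V, hV⟩ := eventually_atTop.1 ((hg.mul_le_Ginv hk0 hr hkr).and
    ((hg.tendsto_Ginv.eventually (hg.le_comp_mul hk0 hkβ)).and hsmall))
  refine ⟨max V 1, by positivity, fun v w hv hw hwv => ?_⟩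
  have hw0 : 0 ≤ w := zero_le_one.trans ((le_max_right _ _).trans hw)
  have hv0 : 0 ≤ v := zero_le_one.trans ((le_max_right _ _).trans hv)
  obtain ⟨h3, h4, -⟩ := hV v ((le_max_left _ _).trans hv)
  have h5 := (hV w ((le_max_left _ _).trans hw)).2.2
  have h6 := h3 w hw0 hwv
  exact h4.trans (hmono.monotoneOn ⟨mul_nonneg hk0.le (hg.Ginv_pos hv0).le, h6.trans h5.2.le⟩
    (Ioo_subset_Icc_self h5) h6)

/-! ### Differential inequalities and comparison -/

theorem exists_first_zero {d : ℝ → ℝ} {T t : ℝ} (hd : ContinuousOn d (Ici T)) (hT : 0 < d T)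
    (ht : T ≤ t) (hdt : d t ≤ 0) :
    ∃ t₀, T < t₀ ∧ d t₀ = 0 ∧ ∀ s ∈ Ico T t₀, 0 < d s := by
  have hcl : IsClosed (Ici T ∩ d ⁻¹' Iic 0) := hd.preimage_isClosed_of_isClosed isClosed_Ici isClosed_Iic
  have hbdd : BddBelow (Ici T ∩ d ⁻¹' Iic 0) := ⟨T, fun s hs => hs.1⟩
  have hmem := hcl.csInf_mem ⟨t, ht, hdt⟩ hbdd
  set t₀ := sInf (Ici T ∩ d ⁻¹' Iic 0) with ht₀
  have hbefore : ∀ s ∈ Ico T t₀, 0 < d s := fun s hs => by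
    by_contra h
    exact absurd (csInf_le hbdd ⟨hs.1, not_lt.1 h⟩) (not_le.2 hs.2)
  have hlt : T < t₀ := lt_of_le_of_ne hmem.1 fun h => by
    have h2 : d t₀ ≤ 0 := hmem.2
    rw [← h] at h2
    exact absurd hT (not_lt.2 h2)
  obtain ⟨z, hz, hz0⟩ := intermediate_value_Icc' hlt.le (hd.mono Icc_subset_Ici_self)
    (show (0 : ℝ) ∈ Icc (d t₀) (d T) from ⟨hmem.2, hT.le⟩)
  rcases hz.2.eq_or_lt with h | h
  · exact ⟨t₀, hlt, h ▸ hz0, hbefore⟩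
  · exact absurd hz0 (hbefore z ⟨hz.1, h⟩).ne'

/-- First contact principle: a function that starts positive and whose derivative is positive at
each first zero stays positive. -/
theorem pos_of_deriv_pos_at_first_zero {d : ℝ → ℝ} {T : ℝ} (hd : ContinuousOn d (Ici T))
    (hT : 0 < d T)
    (h : ∀ t, T < t → d t = 0 → (∀ s ∈ Ico T t, 0 < d s) → ∃ D, 0 < D ∧ HasDerivAt d D t) :
    ∀ t, T ≤ t → 0 < d t := by
  intro t ht
  by_contra hneg
  obtain ⟨t₀, hlt, h0, hbefore⟩ := exists_first_zero hd hT ht (not_lt.1 hneg)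
  obtain ⟨D, hD, hder⟩ := h t₀ hlt h0 hbefore
  have hs := (hasDerivAt_iff_tendsto_slope.1 hder).mono_left
    (nhdsWithin_mono t₀ (fun s hs => ne_of_lt hs : Iio t₀ ⊆ {t₀}ᶜ))
  obtain ⟨s, hs1, hs2⟩ := ((hs.eventually_const_lt hD).and (Ioo_mem_nhdsLT hlt)).exists
  rw [slope_def_field, h0, sub_zero] at hs1
  exact absurd hs1 (div_neg_of_pos_of_neg (hbefore s ⟨hs2.1.le, hs2.2⟩) (sub_neg.2 hs2.2)).not_gt

/-- The two-sided differential inequality that solutions of the delay equation and of the equation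
with maximum functional share. -/
structure DelayInequalities (a b : ℝ) (g τ x : ℝ → ℝ) : Prop where
  cont : ContinuousOn x (Ici 0)
  pos : ∀ t, 0 ≤ t → 0 < x t
  bounds : ∀ t, 0 < t → ∃ D, HasDerivAt x D t ∧ -a * g (x t) + b * g (x (t - τ t)) ≤ D ∧
    ∀ M, (∀ s ∈ Icc (t - τ t) t, g (x s) ≤ M) → D ≤ -a * g (x t) + b * M

/-- Solutions stay positive: as long as `x > 0` one has `(G ∘ x)' ≤ a`, whereas `G ∘ x` would have to
blow up at a first zero of `x`. -/
theorem SolvesWithForcing.pos {a τbar : ℝ} {ψ F x : ℝ → ℝ} (hg : Nonlinearity g β)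
    (hψ : InitialFunction τbar ψ) (hτ : 0 ≤ τbar) (hx : SolvesWithForcing a g τbar ψ F x)
    (hF : ∀ t, 0 ≤ t → (∀ s ∈ Icc (-τbar) t, 0 < x s) → 0 ≤ F t) :
    ∀ t, -τbar ≤ t → 0 < x t := by
  have hinit : ∀ t ∈ Icc (-τbar) 0, 0 < x t := fun t ht => by
    rw [hx.initial t ht]
    exact hψ.2 t ht
  intro t ht
  rcases le_or_gt t 0 with h0 | h0
  · exact hinit t ⟨ht, h0⟩
  by_contra hneg
  have hc : ContinuousOn x (Ici 0) := hx.cont.mono (Ici_subset_Ici.2 (by linarith))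
  obtain ⟨t₀, hlt, hz, hbefore⟩ := exists_first_zero hc (hinit 0 ⟨by linarith, le_rfl⟩) h0.le
    (not_lt.1 hneg)
  have hD : ∀ s ∈ Ioo 0 t₀, HasDerivAt (fun s => G g (x s) - a * s)
      (-(1 / g (x s)) * (-a * g (x s) + F s) - a * 1) s := fun s hs => by
    have h1 := (hx.hasDeriv s hs.1.le).hasDerivAt (Ici_mem_nhds hs.1)
    exact (HasDerivAt.comp s (hg.hasDerivAt_G (hbefore s ⟨hs.1.le, hs.2⟩)) h1).sub
      ((hasDerivAt_id s).const_mul a)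
  have hanti : AntitoneOn (fun s => G g (x s) - a * s) (Ico 0 t₀) := by
    refine antitoneOn_of_deriv_nonpos (convex_Ico 0 t₀) (fun s hs => ?_) ?_ ?_
    · have h1 : ContinuousWithinAt x (Ico 0 t₀) s := (hc s hs.1).mono Ico_subset_Ici_self
      exact ((hg.hasDerivAt_G (hbefore s hs)).continuousAt.comp_continuousWithinAt h1).sub
        (by fun_prop)
    · rw [interior_Ico]
      exact fun s hs => (hD s hs).differentiableAt.differentiableWithinAt
    · rw [interior_Ico]
      intro s hs
      have h1 : 0 < g (x s) := hg.pos _ (hbefore s ⟨hs.1.le, hs.2⟩)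
      have h2 : 0 ≤ F s := hF s hs.1.le fun r hr => by
        rcases le_or_gt r 0 with h | h
        · exact hinit r ⟨hr.1, h⟩
        · exact hbefore r ⟨h.le, hr.2.trans_lt hs.2⟩
      rw [(hD s hs).deriv]
      have h3 : -(1 / g (x s)) * (-a * g (x s) + F s) - a * 1 = -(F s / g (x s)) := by
        field_simp
        ring
      rw [h3, neg_nonpos]
      positivity
  have hlim : Tendsto x (𝓝[<] t₀) (𝓝[>] 0) := by
    have h1 := (hc t₀ hlt.le).mono (Ioo_subset_Icc_self.trans Icc_subset_Ici_self : Ioo 0 t₀ ⊆ Ici 0)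
    rw [ContinuousWithinAt, hz, nhdsWithin_Ioo_eq_nhdsLT hlt] at h1
    refine tendsto_nhdsWithin_iff.2 ⟨h1, ?_⟩
    filter_upwards [Ioo_mem_nhdsLT hlt] with s hs using hbefore s ⟨hs.1.le, hs.2⟩
  obtain ⟨s, hs1, hs2⟩ := (((hg.tendsto_G.comp hlim).eventually_gt_atTop
    (G g (x 0) + |a| * t₀)).and (Ioo_mem_nhdsLT hlt)).exists
  have h4 := hanti (left_mem_Ico.2 hlt) ⟨hs2.1.le, hs2.2⟩ hs2.1.le
  simp only [mul_zero, sub_zero, Function.comp] at h4 hs1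
  have h5 : a * s ≤ |a| * t₀ := by
    have := hs2.1
    exact (mul_le_mul_of_nonneg_right (le_abs_self a) this.le).trans
      (mul_le_mul_of_nonneg_left hs2.2.le (abs_nonneg a))
  linarith

theorem Delay.sub_mem {τ : ℝ → ℝ} {τbar : ℝ} (hτ : Delay τ τbar) {t : ℝ} (ht : 0 ≤ t) :
    -τbar ≤ t - τ t ∧ t - τ t ≤ t :=
  ⟨hτ.isGLB.1 ⟨t, ht, rfl⟩, by linarith [hτ.nonneg t ht]⟩

theorem Delay.tbar_nonneg {τ : ℝ → ℝ} {τbar : ℝ} (hτ : Delay τ τbar) : 0 ≤ τbar := by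
  have := hτ.sub_mem le_rfl
  linarith [this.1.trans this.2]

theorem SolvesDelay.delayInequalities {a b τbar : ℝ} {τ ψ x : ℝ → ℝ} (hb : 0 < b)
    (hg : Nonlinearity g β) (hτ : Delay τ τbar) (hψ : InitialFunction τbar ψ)
    (hx : SolvesDelay a b g τ τbar ψ x) : DelayInequalities a b g τ x := by
  have hb0 := hτ.tbar_nonneg
  have hpos := SolvesWithForcing.pos hg hψ hb0 hx fun t ht h =>
    mul_nonneg hb.le (hg.pos _ (h _ (hτ.sub_mem ht))).le
  refine ⟨hx.cont.mono (Ici_subset_Ici.2 (by linarith)), fun t ht => hpos t (by linarith),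
    fun t ht => ⟨_, (hx.hasDeriv t ht.le).hasDerivAt (Ici_mem_nhds ht), le_rfl, fun M hM => ?_⟩⟩
  have := hM (t - τ t) (left_mem_Icc.2 (hτ.sub_mem ht.le).2)
  gcongr

theorem SolvesMax.delayInequalities {a b τbar : ℝ} {τ ψ x : ℝ → ℝ} (hb : 0 < b)
    (hg : Nonlinearity g β) (hτ : Delay τ τbar) (hψ : InitialFunction τbar ψ)
    (hx : SolvesMax a b g τ τbar ψ x) : DelayInequalities a b g τ x := by
  have hb0 := hτ.tbar_nonneg
  have hpos := SolvesWithForcing.pos hg hψ hb0 hx fun t ht h => by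
    refine mul_nonneg hb.le (Real.sSup_nonneg ?_)
    rintro _ ⟨s, hs, rfl⟩
    exact (hg.pos _ (h s ⟨(hτ.sub_mem ht).1.trans hs.1, hs.2⟩)).le
  refine ⟨hx.cont.mono (Ici_subset_Ici.2 (by linarith)), fun t ht => hpos t (by linarith),
    fun t ht => ⟨_, (hx.hasDeriv t ht.le).hasDerivAt (Ici_mem_nhds ht), ?_, fun M hM => ?_⟩⟩
  · have hsub : Icc (t - τ t) t ⊆ Ici (-τbar) := fun s hs => (hτ.sub_mem ht.le).1.trans hs.1
    have hc : ContinuousOn (fun s => g (x s)) (Icc (t - τ t) t) :=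
      hg.cont.comp (hx.cont.mono hsub) fun s hs => (hpos s (hsub hs)).le
    have := le_csSup (isCompact_Icc.bddAbove_image hc)
      (mem_image_of_mem (fun s => g (x s)) (left_mem_Icc.2 (hτ.sub_mem ht.le).2))
    gcongr
  · have : sSup ((fun s => g (x s)) '' Icc (t - τ t) t) ≤ M := by
      refine csSup_le ((nonempty_Icc.2 (hτ.sub_mem ht.le).2).image _) ?_
      rintro _ ⟨s, hs, rfl⟩
      exact hM s hs
    gcongr

/-- Comparison with a decreasing supersolution `u`. The bound `δ` keeps the delayed values in the range
where `g` is increasing. -/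
theorem DelayInequalities.lt_of_supersolution {a b δ T₀ T : ℝ} {τ x u : ℝ → ℝ}
    (hx : DelayInequalities a b g τ x) (hmono : MonotoneOn g (Icc 0 δ))
    (hT₀ : 0 < T₀) (hT : T₀ ≤ T) (hτ : ∀ t, T ≤ t → T₀ ≤ t - τ t)
    (hinit : ∀ s ∈ Icc T₀ T, x s < u s) (hanti : AntitoneOn u (Ici T₀))
    (hδ : ∀ t, T ≤ t → u (t - τ t) ≤ δ)
    (hu : ∀ t, T ≤ t → ∃ D, HasDerivAt u D t ∧ -a * g (u t) + b * g (u (t - τ t)) < D) :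
    ∀ t, T ≤ t → x t < u t := by
  have hcont : ContinuousOn (fun t => u t - x t) (Ici T) := by
    refine ContinuousOn.sub (fun t ht => ?_) (hx.cont.mono (Ici_subset_Ici.2 (by linarith)))
    obtain ⟨D, hD, -⟩ := hu t ht
    exact hD.continuousAt.continuousWithinAt
  have := pos_of_deriv_pos_at_first_zero hcont (sub_pos.2 (hinit T ⟨hT, le_rfl⟩)) ?_
  · exact fun t ht => sub_pos.1 (this t ht)
  intro t ht h0 hbefore
  obtain ⟨D, hD, hlt⟩ := hu t ht.le
  obtain ⟨E, hE, -, hEle⟩ := hx.bounds t (by linarith)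
  refine ⟨D - E, sub_pos.2 ?_, hD.sub hE⟩
  have hxu : x t = u t := by linarith
  have h1 := hEle (g (u (t - τ t))) fun s hs => by
    have hs0 : T₀ ≤ s := (hτ t ht.le).trans hs.1
    have h2 : x s ≤ u s := by
      rcases lt_or_ge s T with h | h
      · exact (hinit s ⟨hs0, h.le⟩).le
      · rcases hs.2.eq_or_lt with h3 | h3
        · rw [h3, hxu]
        · exact (sub_pos.1 (hbefore s ⟨h, h3⟩)).le
    have h3 : x s ≤ u (t - τ t) := h2.trans (hanti (hτ t ht.le) hs0 hs.1)
    have h4 := hx.pos s (by linarith)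
    have h5 := hδ t ht.le
    exact hmono ⟨h4.le, h3.trans h5⟩ ⟨h4.le.trans h3, h5⟩ h3
  rw [hxu] at h1
  linarith

/-- Comparison with a non-negative subsolution `u`, which need not be monotone. -/
theorem DelayInequalities.lt_of_subsolution {a b δ T₀ T : ℝ} {τ x u : ℝ → ℝ} (hb : 0 < b)
    (hx : DelayInequalities a b g τ x) (hmono : MonotoneOn g (Icc 0 δ))
    (hT₀ : 0 < T₀) (hT : T₀ ≤ T) (hτ : ∀ t, T ≤ t → T₀ ≤ t - τ t ∧ t - τ t ≤ t)
    (hinit : ∀ s ∈ Icc T₀ T, u s < x s) (hpos : ∀ t, T₀ ≤ t → 0 ≤ u t)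
    (hδ : ∀ t, T ≤ t → x (t - τ t) ≤ δ)
    (hu : ∀ t, T ≤ t → ∃ D, HasDerivAt u D t ∧ D < -a * g (u t) + b * g (u (t - τ t))) :
    ∀ t, T ≤ t → u t < x t := by
  have hcont : ContinuousOn (fun t => x t - u t) (Ici T) := by
    refine ContinuousOn.sub (hx.cont.mono (Ici_subset_Ici.2 (by linarith))) (fun t ht => ?_)
    obtain ⟨D, hD, -⟩ := hu t ht
    exact hD.continuousAt.continuousWithinAt
  have := pos_of_deriv_pos_at_first_zero hcont (sub_pos.2 (hinit T ⟨hT, le_rfl⟩)) ?_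
  · exact fun t ht => sub_pos.1 (this t ht)
  intro t ht h0 hbefore
  obtain ⟨D, hD, hlt⟩ := hu t ht.le
  obtain ⟨E, hE, hEle, -⟩ := hx.bounds t (by linarith)
  refine ⟨E - D, sub_pos.2 ?_, hE.sub hD⟩
  have hxu : x t = u t := by linarith
  obtain ⟨hs0, hst⟩ := hτ t ht.le
  have h2 : u (t - τ t) ≤ x (t - τ t) := by
    rcases lt_or_ge (t - τ t) T with h | h
    · exact (hinit _ ⟨hs0, h.le⟩).le
    · rcases hst.eq_or_lt with h3 | h3
      · rw [h3, hxu]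
      · exact (sub_pos.1 (hbefore _ ⟨h, h3⟩)).le
  have h5 := hδ t ht.le
  have h6 := hpos _ hs0
  have h7 : g (u (t - τ t)) ≤ g (x (t - τ t)) := hmono ⟨h6, h2.trans h5⟩ ⟨h6.trans h2, h5⟩ h2
  have h8 : b * g (u (t - τ t)) ≤ b * g (x (t - τ t)) := by gcongr
  rw [hxu] at hEle
  linarith

/-! ### Delays of linear size and a time change -/

theorem Auxiliary.continuousOn_one_div {τ σ : ℝ → ℝ} {τbar T : ℝ} (hσ : Auxiliary τ σ τbar)
    (hτ : Delay τ τbar) (hT : 0 ≤ T) (hpos : ∀ s, T ≤ s → 0 < σ s) :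
    ContinuousOn (fun s => 1 / σ s) (Ici T) :=
  continuousOn_const.div (hσ.cont.mono (Ici_subset_Ici.2 (by linarith [hτ.tbar_nonneg])))
    fun s hs => (hpos s hs).ne'

theorem Auxiliary.integral_le_log {τ σ : ℝ → ℝ} {τbar T p u t : ℝ} (hσ : Auxiliary τ σ τbar)
    (hτ : Delay τ τbar) (hT : 0 < T) (hp : 0 < p) (hle : ∀ s, T ≤ s → p * s ≤ σ s)
    (hu : T ≤ u) (hut : u ≤ t) :
    ∫ s in u..t, 1 / σ s ≤ p⁻¹ * Real.log (t / u) := by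
  have hu0 : 0 < u := hT.trans_le hu
  have hsub : uIcc u t ⊆ Ici T := by
    rw [uIcc_of_le hut]
    exact fun s hs => hu.trans hs.1
  have hc := hσ.continuousOn_one_div hτ hT.le
    fun s hs => (mul_pos hp (hT.trans_le hs)).trans_le (hle s hs)
  have h0 : (0 : ℝ) ∉ uIcc u t := fun h => absurd (hsub h) (not_le.2 hT)
  have hc2 : ContinuousOn (fun s : ℝ => p⁻¹ * (1 / s)) (uIcc u t) :=
    continuousOn_const.mul (continuousOn_const.div continuousOn_id
      fun s hs h => h0 (h ▸ hs))
  rw [← integral_one_div h0, ← intervalIntegral.integral_const_mul]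
  refine intervalIntegral.integral_mono_on hut (hc.mono hsub).intervalIntegrable
    hc2.intervalIntegrable fun s hs => ?_
  have hs0 : 0 < s := hu0.trans_le hs.1
  rw [one_div, one_div, ← mul_inv]
  exact inv_anti₀ (mul_pos hp hs0) (hle s (hu.trans hs.1))

theorem Auxiliary.log_le_integral {τ σ : ℝ → ℝ} {τbar T p u t : ℝ} (hσ : Auxiliary τ σ τbar)
    (hτ : Delay τ τbar) (hT : 0 < T) (hpos : ∀ s, T ≤ s → 0 < σ s)
    (hle : ∀ s, T ≤ s → σ s ≤ p * s) (hu : T ≤ u) (hut : u ≤ t) :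
    p⁻¹ * Real.log (t / u) ≤ ∫ s in u..t, 1 / σ s := by
  have hu0 : 0 < u := hT.trans_le hu
  have hsub : uIcc u t ⊆ Ici T := by
    rw [uIcc_of_le hut]
    exact fun s hs => hu.trans hs.1
  have hc := hσ.continuousOn_one_div hτ hT.le hpos
  have h0 : (0 : ℝ) ∉ uIcc u t := fun h => absurd (hsub h) (not_le.2 hT)
  have hc2 : ContinuousOn (fun s : ℝ => p⁻¹ * (1 / s)) (uIcc u t) :=
    continuousOn_const.mul (continuousOn_const.div continuousOn_id
      fun s hs h => h0 (h ▸ hs))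
  rw [← integral_one_div h0, ← intervalIntegral.integral_const_mul]
  refine intervalIntegral.integral_mono_on hut hc2.intervalIntegrable
    (hc.mono hsub).intervalIntegrable fun s hs => ?_
  rw [one_div, one_div, ← mul_inv]
  exact inv_anti₀ (hpos s (hu.trans hs.1)) (hle s (hu.trans hs.1))

/-- As `1 / σ s ≥ 1 / (p s)`, the integral of `1 / σ` over `[t - τ t, t]`, which tends to `1`, is at least
`log (t / (t - τ t)) / p`. -/
theorem Auxiliary.mul_le_sub_delay {τ σ : ℝ → ℝ} {τbar p q : ℝ} (hσ : Auxiliary τ σ τbar)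
    (hτ : Delay τ τbar) (hp : 0 < p) (hpq : p < q) (hle : ∀ᶠ s in atTop, σ s ≤ p * s) :
    ∀ᶠ t in atTop, Real.exp (-q) * t ≤ t - τ t := by
  obtain ⟨T, hT⟩ := eventually_atTop.1 (hle.and (hσ.tendsto.eventually_gt_atTop 0))
  have h1 : 1 < p⁻¹ * q := by rwa [← div_eq_inv_mul, one_lt_div hp]
  filter_upwards [hσ.integral_delay.eventually_lt_const h1, eventually_ge_atTop 0,
    hτ.tendsto.eventually_ge_atTop (max T 1)] with t h2 ht0 h3
  have hu := (hτ.sub_mem ht0).2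
  have hu0 : 0 < t - τ t := zero_lt_one.trans_le ((le_max_right _ _).trans h3)
  have h4 := hσ.log_le_integral (p := p) hτ (lt_max_of_lt_right one_pos)
    (fun s hs => (hT s ((le_max_left _ _).trans hs)).2)
    (fun s hs => (hT s ((le_max_left _ _).trans hs)).1) h3 hu
  have h5 := lt_of_mul_lt_mul_left (h4.trans_lt h2) (inv_pos.2 hp).le
  rw [Real.log_lt_iff_lt_exp (div_pos (hu0.trans_le hu) hu0), div_lt_iff₀ hu0] at h5
  rw [Real.exp_neg, inv_mul_le_iff₀ (Real.exp_pos q)]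
  exact h5.le

theorem Auxiliary.sub_delay_le_mul {τ σ : ℝ → ℝ} {τbar p q : ℝ} (hσ : Auxiliary τ σ τbar)
    (hτ : Delay τ τbar) (hp : 0 < p) (hpq : q < p) (hle : ∀ᶠ s in atTop, p * s ≤ σ s) :
    ∀ᶠ t in atTop, t - τ t ≤ Real.exp (-q) * t := by
  obtain ⟨T, hT⟩ := eventually_atTop.1 hle
  have h1 : p⁻¹ * q < 1 := by rwa [← div_eq_inv_mul, div_lt_one hp]
  filter_upwards [hσ.integral_delay.eventually_const_lt h1, eventually_ge_atTop 0,
    hτ.tendsto.eventually_ge_atTop (max T 1)] with t h2 ht0 h3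
  have hu := (hτ.sub_mem ht0).2
  have hu0 : 0 < t - τ t := zero_lt_one.trans_le ((le_max_right _ _).trans h3)
  have h4 := hσ.integral_le_log (p := p) hτ (lt_max_of_lt_right one_pos) hp
    (fun s hs => hT s ((le_max_left _ _).trans hs)) h3 hu
  have h5 := lt_of_mul_lt_mul_left (h2.trans_le h4) (inv_pos.2 hp).le
  rw [Real.lt_log_iff_exp_lt (div_pos (hu0.trans_le hu) hu0), lt_div_iff₀ hu0] at h5
  rw [Real.exp_neg, le_inv_mul_iff₀ (Real.exp_pos q)]
  exact h5.le

/-- A time change `φ` that starts at a prescribed value `V` at time `T`, has derivative at most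
`c (1 + θ)`, eventually exceeds `c' t`, and satisfies `φ (ρ t) ≥ ρ ^ (1 + θ) φ t`. It is given by
`c / φ t = t⁻¹ + A t ^ (-(1 + θ))` for a suitable `A > 0`. -/
theorem exists_time_change {c c' θ V T : ℝ} (hc' : 0 < c') (hc : c' < c) (hθ : 0 < θ) (hV : 0 < V)
    (hT : 0 < T) (hVT : V < c * T) :
    ∃ φ : ℝ → ℝ, φ T = V ∧ (∀ t, 0 < t → 0 < φ t) ∧ MonotoneOn φ (Ioi 0) ∧
      (∀ t, 0 < t → ∃ D, HasDerivAt φ D t ∧ D ≤ c * (1 + θ)) ∧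
      (∀ ρ s t, 0 < ρ → ρ ≤ 1 → 0 < t → ρ * t ≤ s → ρ ^ (1 + θ) * φ t ≤ φ s) ∧
      ∀ᶠ t in atTop, c' * t ≤ φ t := by
  have hc0 : 0 < c := hc'.trans hc
  set A := (c / V - T⁻¹) * T ^ (1 + θ) with hA
  have hA0 : 0 < A := by
    refine mul_pos (sub_pos.2 ?_) (Real.rpow_pos_of_pos hT _)
    rw [inv_eq_one_div, div_lt_div_iff₀ hT hV]
    linarith
  set w : ℝ → ℝ := fun t => t⁻¹ + A * t ^ (-(1 + θ)) with hw
  have hw0 : ∀ t, 0 < t → 0 < w t := fun t ht => by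
    have := Real.rpow_pos_of_pos ht (-(1 + θ))
    positivity
  have hwanti : ∀ s t, 0 < s → s ≤ t → w t ≤ w s := fun s t hs hst =>
    add_le_add (inv_anti₀ hs hst) (mul_le_mul_of_nonneg_left
      (Real.rpow_le_rpow_of_nonpos hs hst (by linarith)) hA0.le)
  refine ⟨fun t => c / w t, ?_, fun t ht => div_pos hc0 (hw0 t ht), ?_, ?_, ?_, ?_⟩
  · have : w T = c / V := by
      simp only [hw, hA]
      rw [mul_assoc, ← Real.rpow_add hT, add_neg_cancel, Real.rpow_zero]
      ring
    simp only [this]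
    field_simp
  · intro s hs t ht hst
    exact div_le_div_of_nonneg_left hc0.le (hw0 t ht) (hwanti s t hs hst)
  · intro t ht
    have hD : HasDerivAt w (-(t ^ 2)⁻¹ + A * (-(1 + θ) * t ^ (-(1 + θ) - 1))) t :=
      (hasDerivAt_inv ht.ne').add ((Real.hasDerivAt_rpow_const (Or.inl ht.ne')).const_mul A)
    refine ⟨_, (hasDerivAt_const t c).div hD (hw0 t ht).ne', ?_⟩
    have hp : 0 < t ^ (-(1 + θ)) := Real.rpow_pos_of_pos ht _
    rw [div_le_iff₀ (by have := hw0 t ht; positivity)]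
    have h1 : t ^ (-(1 + θ) - 1) = t ^ (-(1 + θ)) * t⁻¹ := by
      rw [Real.rpow_sub_one ht.ne', div_eq_mul_inv]
    have h2 : t⁻¹ ≤ w t := by simp only [hw]; nlinarith
    have h3 : -(-(t ^ 2)⁻¹ + A * (-(1 + θ) * t ^ (-(1 + θ) - 1))) ≤ (1 + θ) * (w t * t⁻¹) := by
      rw [h1]
      simp only [hw]
      have : 0 < (t ^ 2)⁻¹ := by positivity
      have h4 : t⁻¹ * t⁻¹ = (t ^ 2)⁻¹ := by rw [← mul_inv, sq]
      nlinarith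
    have h5 : w t * t⁻¹ ≤ w t ^ 2 := by
      rw [sq]
      exact mul_le_mul_of_nonneg_left h2 (hw0 t ht).le
    calc 0 * w t - c * (-(t ^ 2)⁻¹ + A * (-(1 + θ) * t ^ (-(1 + θ) - 1)))
        = c * -(-(t ^ 2)⁻¹ + A * (-(1 + θ) * t ^ (-(1 + θ) - 1))) := by ring
      _ ≤ c * ((1 + θ) * w t ^ 2) := by
          refine mul_le_mul_of_nonneg_left (h3.trans ?_) hc0.le
          gcongr
      _ = c * (1 + θ) * w t ^ 2 := by ring
  · intro ρ s t hρ hρ1 ht hs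
    have hρt : 0 < ρ * t := mul_pos hρ ht
    have hP : 0 < ρ ^ (1 + θ) := Real.rpow_pos_of_pos hρ _
    have h1 : ρ ^ (1 + θ) ≤ ρ := by
      simpa using Real.rpow_le_rpow_of_exponent_ge hρ hρ1 (show (1 : ℝ) ≤ 1 + θ by linarith)
    have h2 : ρ ^ (1 + θ) * w (ρ * t) ≤ w t := by
      simp only [hw]
      rw [Real.mul_rpow hρ.le ht.le, mul_add]
      refine add_le_add ?_ (le_of_eq ?_)
      · rw [mul_inv, ← mul_assoc]
        refine mul_le_of_le_one_left (inv_pos.2 ht).le ?_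
        rwa [← div_eq_mul_inv, div_le_one hρ]
      · rw [show ρ ^ (1 + θ) * (A * (ρ ^ (-(1 + θ)) * t ^ (-(1 + θ)))) =
          (ρ ^ (1 + θ) * ρ ^ (-(1 + θ))) * (A * t ^ (-(1 + θ))) by ring, ← Real.rpow_add hρ,
          add_neg_cancel, Real.rpow_zero, one_mul]
    have hs0 : 0 < s := hρt.trans_le hs
    have h3 : ρ ^ (1 + θ) * w s ≤ w t :=
      (mul_le_mul_of_nonneg_left (hwanti _ _ hρt hs) hP.le).trans h2
    simp only
    rw [← mul_div_assoc, div_le_div_iff₀ (hw0 t ht) (hw0 s hs0)]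
    nlinarith
  · have h1 : Tendsto (fun t : ℝ => 1 + A * t ^ (-θ)) atTop (𝓝 (1 + A * 0)) :=
      ((tendsto_rpow_neg_atTop hθ).const_mul A).const_add 1
    have h2 : 1 + A * 0 < c / c' := by rw [mul_zero, add_zero]; exact (one_lt_div hc').2 hc
    filter_upwards [h1.eventually_lt_const h2, eventually_gt_atTop 0] with t h3 ht
    rw [lt_div_iff₀ hc'] at h3
    rw [le_div_iff₀ (hw0 t ht)]
    have h4 : t * w t = 1 + A * t ^ (-θ) := by
      simp only [hw]
      rw [mul_add, mul_inv_cancel₀ ht.ne', show -θ = -(1 + θ) + 1 by ring, Real.rpow_add_one ht.ne']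
      ring
    rw [mul_assoc, h4]
    linarith

/-! ### Decay at the rate of `Ginv` -/

/-- Upper estimate: `Ginv ∘ φ` is a supersolution for the time change `φ` of `exists_time_change`,
and at its starting time it exceeds the solution. -/
theorem DelayInequalities.le_Ginv {a b l c τbar : ℝ} {τ x : ℝ → ℝ} (hb : 0 < b)
    (hg : Nonlinearity g β) (hτ : Delay τ τbar) (hx : DelayInequalities a b g τ x)
    (hx0 : Tendsto x atTop (𝓝 0))
    (hdelay : ∀ q, l < q → ∀ᶠ t in atTop, Real.exp (-q) * t ≤ t - τ t) (hl : 0 ≤ l)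
    (hc0 : 0 < c) (hc : c < a - b * Real.exp (l * (β / (β - 1)))) :
    ∀ᶠ t in atTop, x t ≤ Ginv g (c * t) := by
  obtain ⟨c₂, hcc₂, hc₂⟩ := exists_between hc
  have hc₂0 : 0 < c₂ := hc0.trans hcc₂
  -- All error terms are controlled by one small parameter `θ`.
  obtain ⟨θ, hθ, hθc⟩ : ∃ θ > 0,
      c₂ * (1 + θ) < a - b * Real.exp ((l + θ) * (1 + θ) * (β / (β - 1))) := by
    have h1 : Tendsto (fun θ : ℝ => a - b * Real.exp ((l + θ) * (1 + θ) * (β / (β - 1))) -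
        c₂ * (1 + θ)) (𝓝[>] 0) (𝓝 (a - b * Real.exp ((l + 0) * (1 + 0) * (β / (β - 1))) -
        c₂ * (1 + 0))) :=
      ((by fun_prop : Continuous (fun θ : ℝ => a - b * Real.exp ((l + θ) * (1 + θ) * (β / (β - 1))) -
        c₂ * (1 + θ))).tendsto 0).mono_left nhdsWithin_le_nhds
    have h2 : 0 < a - b * Real.exp ((l + 0) * (1 + 0) * (β / (β - 1))) - c₂ * (1 + 0) := by
      simp only [add_zero, mul_one]
      linarith
    obtain ⟨θ, h3, h4⟩ := ((h1.eventually_const_lt h2).and self_mem_nhdsWithin).exists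
    exact ⟨θ, h4, sub_pos.1 h3⟩
  set q := l + θ with hq
  have hq0 : 0 < q := by positivity
  obtain ⟨M, hM1, hM2⟩ : ∃ M, Real.exp (q * (1 + θ) * (β / (β - 1))) < M ∧
      M < (a - c₂ * (1 + θ)) / b :=
    exists_between (by rw [lt_div_iff₀ hb]; linarith)
  rw [lt_div_iff₀ hb] at hM2
  set ρ := Real.exp (-q) with hρ
  have hρ0 : 0 < ρ := Real.exp_pos _
  have hρ1 : ρ ≤ 1 := Real.exp_le_one_iff.2 (by linarith)
  set r := ρ ^ (1 + θ) with hr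
  have hr0 : 0 < r := Real.rpow_pos_of_pos hρ0 _
  have hrM : r ^ (-(β / (β - 1))) < M := by
    rw [hr, hρ, ← Real.exp_mul, ← Real.exp_mul]
    convert hM1 using 2
    ring
  obtain ⟨δ, hδ, hmono⟩ := hg.exists_strictMonoOn
  have hrlim : Tendsto (fun v => r * v) atTop atTop := tendsto_id.const_mul_atTop hr0
  obtain ⟨V₀, hV₀⟩ := eventually_atTop.1 ((hg.g_Ginv_le_mul hr0 hrM).and
    ((hg.tendsto_Ginv.comp hrlim).eventually (Ioo_mem_nhdsGT hδ)))
  set V := max V₀ 1 with hV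
  have hV0 : 0 < V := lt_max_of_lt_right one_pos
  obtain ⟨T₀', hT₀'⟩ := eventually_atTop.1
    (hx0.eventually_lt_const (hg.Ginv_pos hV0.le))
  set T₀ := max T₀' 1 with hT₀
  have hT₀0 : 0 < T₀ := lt_max_of_lt_right one_pos
  obtain ⟨T', hT'⟩ := eventually_atTop.1 ((hτ.tendsto.eventually_ge_atTop T₀).and
    (hdelay q (by linarith)))
  set T := max T' (max T₀ (V / c₂ + 1)) with hT
  have hT₀T : T₀ ≤ T := (le_max_left _ _).trans (le_max_right _ _)
  have hT0 : 0 < T := hT₀0.trans_le hT₀T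
  have hVT : V < c₂ * T := by
    have : V / c₂ + 1 ≤ T := (le_max_right _ _).trans (le_max_right _ _)
    rw [← div_lt_iff₀' hc₂0]
    linarith
  obtain ⟨φ, hφT, hφ0, hφm, hφD, hφs, hφl⟩ :=
    exists_time_change hc0 hcc₂ hθ hV0 hT0 hVT
  have hφV : ∀ t, T ≤ t → V ≤ φ t := fun t ht => hφT ▸ hφm hT0 (hT0.trans_le ht) ht
  have hdel : ∀ t, T ≤ t → T₀ ≤ t - τ t ∧ r * φ t ≤ φ (t - τ t) := fun t ht => by
    obtain ⟨h1, h2⟩ := hT' t ((le_max_left _ _).trans ht)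
    exact ⟨h1, hφs ρ _ t hρ0 hρ1 (hT0.trans_le ht) h2⟩
  have hanti : AntitoneOn (fun t => Ginv g (φ t)) (Ici T₀) := fun s hs t ht hst => by
    have hs0 : 0 < s := hT₀0.trans_le hs
    have ht0 : 0 < t := hT₀0.trans_le ht
    exact hg.strictAntiOn_Ginv.antitoneOn (mem_Ici.2 (hφ0 s hs0).le) (mem_Ici.2 (hφ0 t ht0).le)
      (hφm hs0 ht0 hst)
  have hcomp := hx.lt_of_supersolution (u := fun t => Ginv g (φ t)) (δ := δ) hmono.monotoneOn hT₀0
    hT₀T (fun t ht => (hdel t ht).1) ?_ hanti ?_ ?_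
  · filter_upwards [hφl, eventually_ge_atTop T] with t h1 h2
    have ht0 := hT0.trans_le h2
    exact (hcomp t h2).le.trans (hg.strictAntiOn_Ginv.antitoneOn (mem_Ici.2 (by positivity))
      (mem_Ici.2 (hφ0 t ht0).le) h1)
  · intro s hs
    have h1 := hanti hs.1 hT₀T hs.2
    simp only [hφT] at h1
    exact (hT₀' s ((le_max_left _ _).trans hs.1)).trans_le h1
  · intro t ht
    have h1 := (hV₀ (φ t) ((le_max_left _ _).trans (hφV t ht))).2
    have h2 := hφ0 t (hT0.trans_le ht)
    have h3 := hdel t ht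
    exact (hg.strictAntiOn_Ginv.antitoneOn (mem_Ici.2 (by positivity))
      (mem_Ici.2 (hφ0 _ (hT₀0.trans_le h3.1)).le) h3.2).trans h1.2.le
  · intro t ht
    have ht0 := hT0.trans_le ht
    obtain ⟨D, hD, hDle⟩ := hφD t ht0
    refine ⟨_, HasDerivAt.comp t (hg.hasDerivAt_Ginv (hφ0 t ht0)) hD, ?_⟩
    have h1 := (hV₀ (φ t) ((le_max_left _ _).trans (hφV t ht))).1 _ (hdel t ht).2
    have h2 : 0 < g (Ginv g (φ t)) := hg.pos _ (hg.Ginv_pos (hφ0 t ht0).le)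
    have h3 : b * g (Ginv g (φ (t - τ t))) ≤ b * (M * g (Ginv g (φ t))) := by gcongr
    have h4 : g (Ginv g (φ t)) * D ≤ g (Ginv g (φ t)) * (c₂ * (1 + θ)) := by gcongr
    have h5 : g (Ginv g (φ t)) * (M * b) < g (Ginv g (φ t)) * (a - c₂ * (1 + θ)) := by gcongr
    linarith

/-- Lower estimate: `Ginv (c₂ t + A t ^ (1 - θ))`, with `c₂` slightly below `c`, is a subsolution, and the
free constant `A` makes it start below the solution. -/
theorem DelayInequalities.Ginv_le {a b l c τbar : ℝ} {τ x : ℝ → ℝ} (hb : 0 < b)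
    (hg : Nonlinearity g β) (hτ : Delay τ τbar) (hx : DelayInequalities a b g τ x)
    (hx0 : Tendsto x atTop (𝓝 0))
    (hdelay : ∀ q, q < l → ∀ᶠ t in atTop, t - τ t ≤ Real.exp (-q) * t)
    (hc0 : 0 < c) (hc : a - b * Real.exp (l * (β / (β - 1))) < c) :
    ∀ᶠ t in atTop, Ginv g (c * t) ≤ x t := by
  have hβ1 : 0 < β - 1 := sub_pos.2 hg.one_lt
  have hβ' : 0 < β / (β - 1) := div_pos (by linarith) hβ1
  obtain ⟨c₂, hc₂, hcc₂⟩ := exists_between (max_lt hc hc0)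
  obtain ⟨hc₂, hc₂0⟩ := max_lt_iff.1 hc₂
  obtain ⟨θ, hθ, hθ1, hθc⟩ : ∃ θ > 0, θ < 1 ∧
      a - b * Real.exp ((l - θ) * (1 - θ) * (β / (β - 1))) < c₂ := by
    have h1 : Tendsto (fun θ : ℝ => a - b * Real.exp ((l - θ) * (1 - θ) * (β / (β - 1))))
        (𝓝[>] 0) (𝓝 (a - b * Real.exp ((l - 0) * (1 - 0) * (β / (β - 1))))) :=
      ((by fun_prop : Continuous (fun θ : ℝ =>
        a - b * Real.exp ((l - θ) * (1 - θ) * (β / (β - 1))))).tendsto 0).mono_left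
        nhdsWithin_le_nhds
    have h2 : a - b * Real.exp ((l - 0) * (1 - 0) * (β / (β - 1))) < c₂ := by
      simpa only [sub_zero, mul_one] using hc₂
    obtain ⟨θ, h3, h4⟩ := ((h1.eventually_lt_const h2).and
      (Ioo_mem_nhdsGT (zero_lt_one (α := ℝ)))).exists
    exact ⟨θ, h4.1, h4.2, h3⟩
  set q := l - θ with hq
  obtain ⟨M, hM1, hM2⟩ : ∃ M, max ((a - c₂) / b) 0 < M ∧
      M < Real.exp (q * (1 - θ) * (β / (β - 1))) :=
    exists_between (max_lt (by rw [div_lt_iff₀ hb]; linarith) (Real.exp_pos _))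
  obtain ⟨hM1, hM0⟩ := max_lt_iff.1 hM1
  rw [div_lt_iff₀ hb] at hM1
  set ρ := min 1 (Real.exp (-q)) with hρ
  have hρ0 : 0 < ρ := lt_min one_pos (Real.exp_pos _)
  have hρ1 : ρ ≤ 1 := min_le_left _ _
  set r := ρ ^ (1 - θ) with hr
  have hr0 : 0 < r := Real.rpow_pos_of_pos hρ0 _
  have hrM : M < r ^ (-(β / (β - 1))) := by
    refine hM2.trans_le ?_
    have h1 : r ≤ Real.exp (-q) ^ (1 - θ) :=
      Real.rpow_le_rpow hρ0.le (min_le_right _ _) (by linarith)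
    refine le_trans (le_of_eq ?_) (Real.rpow_le_rpow_of_nonpos hr0 h1 (by linarith))
    rw [← Real.exp_mul, ← Real.exp_mul]
    congr 1
    ring
  have hρr : ρ ≤ r := by
    simpa using Real.rpow_le_rpow_of_exponent_ge hρ0 hρ1 (show 1 - θ ≤ 1 by linarith)
  obtain ⟨δ, hδ, hmono⟩ := hg.exists_strictMonoOn
  obtain ⟨V, hV0, hV⟩ := hg.mul_le_g_Ginv hr0 hM0 hrM
  obtain ⟨T₀', hT₀'⟩ := eventually_atTop.1 (hx0.eventually_lt_const hδ)
  set T₀ := max T₀' (max 1 (V / c₂)) with hT₀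
  have hT₀1 : 1 ≤ T₀ := (le_max_left _ _).trans (le_max_right _ _)
  have hT₀V : V ≤ c₂ * T₀ := by
    rw [← div_le_iff₀' hc₂0]
    exact (le_max_right _ _).trans (le_max_right _ _)
  obtain ⟨T', hT'⟩ := eventually_atTop.1 ((hτ.tendsto.eventually_ge_atTop T₀).and
    (hdelay q (by linarith)))
  set T := max T' T₀ with hT
  have hT₀T : T₀ ≤ T := le_max_right _ _
  have hT₀0 : 0 < T₀ := one_pos.trans_le hT₀1
  have hT0 : 0 < T := hT₀0.trans_le hT₀T
  have hdel : ∀ t, T ≤ t → T₀ ≤ t - τ t ∧ t - τ t ≤ t ∧ t - τ t ≤ ρ * t := fun t ht => by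
    obtain ⟨h1, h2⟩ := hT' t ((le_max_left _ _).trans ht)
    have ht0 : 0 < t := hT0.trans_le ht
    have h3 := (hτ.sub_mem ht0.le).2
    refine ⟨h1, h3, ?_⟩
    rw [hρ, min_mul_of_nonneg _ _ ht0.le, one_mul]
    exact le_min h3 h2
  obtain ⟨z, hz, hzmin⟩ := (isCompact_Icc (a := T₀) (b := T)).exists_isMinOn
    (nonempty_Icc.2 hT₀T) (hx.cont.mono fun s hs => hT₀0.le.trans hs.1)
  have hz0 : 0 < x z := hx.pos z (hT₀0.le.trans hz.1)
  obtain ⟨A, hA1, hA0⟩ := ((hg.tendsto_Ginv.eventually (Ioo_mem_nhdsGT hz0)).and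
    (eventually_gt_atTop 0)).exists
  set φ : ℝ → ℝ := fun t => c₂ * t + A * t ^ (1 - θ) with hφ
  have hφV : ∀ t, T₀ ≤ t → V ≤ φ t := fun t ht => by
    have h1 : c₂ * T₀ ≤ c₂ * t := by gcongr
    have h2 : 0 < A * t ^ (1 - θ) := mul_pos hA0 (Real.rpow_pos_of_pos (hT₀0.trans_le ht) _)
    simp only [hφ]
    linarith
  have hcomp := hx.lt_of_subsolution (u := fun t => Ginv g (φ t)) (δ := δ) hb hmono.monotoneOn hT₀0
    hT₀T (fun t ht => ⟨(hdel t ht).1, (hdel t ht).2.1⟩) ?_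
    (fun t ht => (hg.Ginv_pos (hV0.le.trans (hφV t ht))).le)
    (fun t ht => (hT₀' _ ((le_max_left _ _).trans (hdel t ht).1)).le) ?_
  · have h1 : Tendsto (fun t : ℝ => c₂ + A * t ^ (-θ)) atTop (𝓝 (c₂ + A * 0)) :=
      ((tendsto_rpow_neg_atTop hθ).const_mul A).const_add c₂
    rw [mul_zero, add_zero] at h1
    filter_upwards [h1.eventually_lt_const hcc₂, eventually_ge_atTop T] with t h2 h3
    have ht0 := hT0.trans_le h3
    refine le_trans ?_ (hcomp t h3).le
    refine hg.strictAntiOn_Ginv.antitoneOn (mem_Ici.2 (hV0.le.trans (hφV t (hT₀T.trans h3))))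
      (mem_Ici.2 (by positivity)) ?_
    simp only [hφ]
    rw [show 1 - θ = -θ + 1 by ring, Real.rpow_add_one ht0.ne']
    nlinarith
  · intro s hs
    have hs1 : 1 ≤ s := hT₀1.trans hs.1
    have h1 : A ≤ φ s := by
      have h2 : 1 ≤ s ^ (1 - θ) := Real.one_le_rpow hs1 (by linarith)
      have h3 : 0 < c₂ * s := by positivity
      simp only [hφ]
      nlinarith
    exact ((hg.strictAntiOn_Ginv.antitoneOn (mem_Ici.2 hA0.le)
      (mem_Ici.2 (hA0.le.trans h1)) h1).trans_lt hA1.2).trans_le (hzmin hs)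
  · intro t ht
    have ht0 := hT0.trans_le ht
    have hφ0 : 0 < φ t := hV0.trans_le (hφV t (hT₀T.trans ht))
    have hD : HasDerivAt φ (c₂ * 1 + A * ((1 - θ) * t ^ (1 - θ - 1))) t :=
      ((hasDerivAt_id t).const_mul c₂).add
        ((Real.hasDerivAt_rpow_const (Or.inl ht0.ne')).const_mul A)
    refine ⟨_, HasDerivAt.comp t (hg.hasDerivAt_Ginv hφ0) hD, ?_⟩
    obtain ⟨hd1, -, hd2⟩ := hdel t ht
    have hd0 : 0 < t - τ t := hT₀0.trans_le hd1
    have hle : φ (t - τ t) ≤ r * φ t := by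
      have h1 : (t - τ t) ^ (1 - θ) ≤ r * t ^ (1 - θ) := by
        rw [hr, ← Real.mul_rpow hρ0.le ht0.le]
        exact Real.rpow_le_rpow hd0.le hd2 (by linarith)
      have h2 : t - τ t ≤ r * t := hd2.trans (by gcongr)
      have h3 : c₂ * (t - τ t) ≤ c₂ * (r * t) := by gcongr
      have h4 : A * (t - τ t) ^ (1 - θ) ≤ A * (r * t ^ (1 - θ)) := by gcongr
      simp only [hφ]
      linarith
    have h1 := hV (φ t) _ (hφV t (hT₀T.trans ht)) (hφV _ hd1) hle
    have h2 : 0 < g (Ginv g (φ t)) := hg.pos _ (hg.Ginv_pos hφ0.le)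
    have h3 : b * (M * g (Ginv g (φ t))) ≤ b * g (Ginv g (φ (t - τ t))) := by gcongr
    have h4 : g (Ginv g (φ t)) * c₂ ≤
        g (Ginv g (φ t)) * (c₂ * 1 + A * ((1 - θ) * t ^ (1 - θ - 1))) := by
      refine mul_le_mul_of_nonneg_left ?_ h2.le
      have h5 : 0 < t ^ (1 - θ - 1) := Real.rpow_pos_of_pos ht0 _
      have h6 : 0 < A * ((1 - θ) * t ^ (1 - θ - 1)) :=
        mul_pos hA0 (mul_pos (by linarith) h5)
      linarith
    have h5 : g (Ginv g (φ t)) * (a - c₂) < g (Ginv g (φ t)) * (M * b) := by gcongr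
    linarith

/-- For `κ = a - b exp (l β / (β - 1)) > 0`, the solution lies between `Ginv (c t)` with `c < κ` and
`Ginv (c t)` with `c > κ`, and `Ginv (c t) / Ginv t → c ^ (-1 / (β - 1))`. -/
theorem DelayInequalities.tendsto_div_Ginv {a b l τbar : ℝ} {τ x : ℝ → ℝ} (hb : 0 < b)
    (hg : Nonlinearity g β) (hτ : Delay τ τbar) (hx : DelayInequalities a b g τ x)
    (hx0 : Tendsto x atTop (𝓝 0))
    (hdelay₁ : ∀ q, l < q → ∀ᶠ t in atTop, Real.exp (-q) * t ≤ t - τ t)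
    (hdelay₂ : ∀ q, q < l → ∀ᶠ t in atTop, t - τ t ≤ Real.exp (-q) * t) (hl : 0 ≤ l)
    (hκ : 0 < a - b * Real.exp (l * (β / (β - 1)))) :
    Tendsto (fun t => x t / Ginv g t) atTop
      (𝓝 ((a - b * Real.exp (l * (β / (β - 1)))) ^ (-1 / (β - 1)))) := by
  have hβ1 : 0 < β - 1 := sub_pos.2 hg.one_lt
  set κ := a - b * Real.exp (l * (β / (β - 1))) with hκdef
  have hΛ : 0 < κ ^ (-1 / (β - 1)) := Real.rpow_pos_of_pos hκ _
  have hΛκ : (κ ^ (-1 / (β - 1))) ^ (1 - β) = κ := by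
    rw [← Real.rpow_mul hκ.le, show -1 / (β - 1) * (1 - β) = 1 by field_simp; ring, Real.rpow_one]
  refine tendsto_order.2 ⟨fun k hk => ?_, fun k hk => ?_⟩
  · obtain ⟨k', hk1, hk2⟩ := exists_between (max_lt hk hΛ)
    obtain ⟨hk1, hk0⟩ := max_lt_iff.1 hk1
    have h1 : κ < k' ^ (1 - β) := by
      rw [← hΛκ]
      exact Real.rpow_lt_rpow_of_neg hk0 hk2 (by linarith)
    obtain ⟨c, hc1, hc2⟩ := exists_between h1
    have hc0 := hκ.trans hc1
    filter_upwards [hx.Ginv_le hb hg hτ hx0 hdelay₂ hc0 hc1, hg.mul_le_Ginv hk0 hc0 hc2,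
      eventually_ge_atTop 0] with t h2 h3 h4
    rw [lt_div_iff₀ (hg.Ginv_pos h4)]
    calc k * Ginv g t < k' * Ginv g t := mul_lt_mul_of_pos_right hk1 (hg.Ginv_pos h4)
      _ ≤ Ginv g (c * t) := h3 _ (by positivity) le_rfl
      _ ≤ x t := h2
  · obtain ⟨k', hk1, hk2⟩ := exists_between hk
    have hk0 := hΛ.trans hk1
    have h1 : k' ^ (1 - β) < κ := by
      rw [← hΛκ]
      exact Real.rpow_lt_rpow_of_neg hΛ hk1 (by linarith)
    obtain ⟨c, hc1, hc2⟩ := exists_between h1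
    have hc0 : 0 < c := (Real.rpow_pos_of_pos hk0 _).trans hc1
    filter_upwards [hx.le_Ginv hb hg hτ hx0 hdelay₁ hl hc0 hc2, hg.Ginv_le_mul hk0 hc1,
      eventually_ge_atTop 0] with t h2 h3 h4
    rw [div_lt_iff₀ (hg.Ginv_pos h4)]
    calc x t ≤ Ginv g (c * t) := h2
      _ ≤ k' * Ginv g t := h3 _ le_rfl
      _ < k * Ginv g t := mul_lt_mul_of_pos_right hk2 (hg.Ginv_pos h4)

/-! ### Decay on the logarithmic scale -/

theorem Auxiliary.intervalIntegrable {τ σ : ℝ → ℝ} {τbar u t : ℝ} (hσ : Auxiliary τ σ τbar)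
    (hu : 0 ≤ u) (ht : 0 ≤ t) :
    IntervalIntegrable (fun s => 1 / σ s) MeasureTheory.volume u t := by
  obtain ⟨r, hr1, hr2⟩ := ((hσ.integral_atTop.eventually_gt_atTop 0).and
    (eventually_ge_atTop (max u t))).exists
  have h : IntervalIntegrable (fun s => 1 / σ s) MeasureTheory.volume 0 r := by
    by_contra h
    rw [intervalIntegral.integral_undef h] at hr1
    exact lt_irrefl _ hr1
  have hr : 0 ≤ r := hu.trans ((le_max_left _ _).trans hr2)
  refine h.mono_set (uIcc_subset_uIcc ?_ ?_) <;> rw [uIcc_of_le hr]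
  · exact ⟨hu, (le_max_left _ _).trans hr2⟩
  · exact ⟨ht, (le_max_right _ _).trans hr2⟩

theorem Auxiliary.integral_sub {τ σ : ℝ → ℝ} {τbar u t : ℝ} (hσ : Auxiliary τ σ τbar)
    (hu : 0 ≤ u) (ht : 0 ≤ t) :
    (∫ s in (0 : ℝ)..t, 1 / σ s) - ∫ s in (0 : ℝ)..u, 1 / σ s = ∫ s in u..t, 1 / σ s :=
  intervalIntegral.integral_interval_sub_left (hσ.intervalIntegrable le_rfl ht)
    (hσ.intervalIntegrable le_rfl hu)

theorem Auxiliary.monotoneOn_integral {τ σ : ℝ → ℝ} {τbar : ℝ} (hσ : Auxiliary τ σ τbar)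
    (hτ : Delay τ τbar) : MonotoneOn (fun t => ∫ s in (0 : ℝ)..t, 1 / σ s) (Ici 0) := by
  intro u hu t ht hut
  rw [← sub_nonneg, hσ.integral_sub hu ht]
  refine intervalIntegral.integral_nonneg hut fun s hs => one_div_nonneg.2 (hσ.nonneg s ?_)
  have h1 : 0 ≤ s := le_trans hu hs.1
  linarith [hτ.tbar_nonneg]

theorem Auxiliary.hasDerivAt_integral {τ σ : ℝ → ℝ} {τbar T t : ℝ} (hσ : Auxiliary τ σ τbar)
    (hτ : Delay τ τbar) (hT : 0 ≤ T) (hpos : ∀ s, T ≤ s → 0 < σ s) (ht : T < t) :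
    HasDerivAt (fun t => ∫ s in (0 : ℝ)..t, 1 / σ s) (1 / σ t) t := by
  have hc := (hσ.continuousOn_one_div hτ hT hpos).mono Ioi_subset_Ici_self
  exact intervalIntegral.integral_hasDerivAt_right (hσ.intervalIntegrable le_rfl (hT.trans ht.le))
    (hc.stronglyMeasurableAtFilter isOpen_Ioi t ht) (hc.continuousAt (Ioi_mem_nhds ht))

/-- Lower estimate: for `ν > log (a / b) / β` a small multiple of `exp (-ν ∫ 1 / σ)` is a subsolution,
since its delayed value exceeds its present value by a factor tending to `exp ν`. -/
theorem DelayInequalities.exp_le {a b ν τbar : ℝ} {τ σ x : ℝ → ℝ} (hb : 0 < b)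
    (hg : Nonlinearity g β) (hτ : Delay τ τbar) (hσ : Auxiliary τ σ τbar)
    (hx : DelayInequalities a b g τ x) (hx0 : Tendsto x atTop (𝓝 0)) (hν : 0 < ν)
    (hνab : a < b * Real.exp (β * ν)) :
    ∃ A > 0, ∀ᶠ t in atTop, A * Real.exp (-ν * ∫ s in (0 : ℝ)..t, 1 / σ s) ≤ x t := by
  obtain ⟨ν₁, hν₁, hν₁ν⟩ : ∃ ν₁, a < b * Real.exp (β * ν₁) ∧ ν₁ < ν := by
    have h1 : Tendsto (fun z => b * Real.exp (β * z)) (𝓝[<] ν) (𝓝 (b * Real.exp (β * ν))) :=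
      ((by fun_prop : Continuous fun z => b * Real.exp (β * z)).tendsto ν).mono_left
        nhdsWithin_le_nhds
    exact ((h1.eventually_const_lt hνab).and self_mem_nhdsWithin).exists
  set k := Real.exp ν₁ with hk
  have hk0 : 0 < k := Real.exp_pos _
  obtain ⟨K, hK1, hK2⟩ : ∃ K, a / b < K ∧ K < k ^ β :=
    exists_between (by rw [div_lt_iff₀ hb, hk, ← Real.exp_mul, mul_comm ν₁]; linarith)
  rw [div_lt_iff₀ hb] at hK1
  obtain ⟨δ, hδ, hmono⟩ := hg.exists_strictMonoOn
  obtain ⟨d, hd0, hd⟩ := mem_nhdsGT_iff_exists_Ioo_subset.1 (hg.le_comp_mul hk0 hK2)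
  set S : ℝ → ℝ := fun t => ∫ s in (0 : ℝ)..t, 1 / σ s with hS
  have hSmono := hσ.monotoneOn_integral hτ
  have hS0 : ∀ t, 0 ≤ t → 0 ≤ S t := fun t ht => by
    have := hSmono self_mem_Ici ht ht
    simpa [hS] using this
  obtain ⟨T₀', hT₀'⟩ := eventually_atTop.1
    ((hx0.eventually_lt_const hδ).and (hσ.tendsto.eventually_gt_atTop 0))
  set T₀ := max T₀' 1 with hT₀
  have hT₀0 : 0 < T₀ := lt_max_of_lt_right one_pos
  have hνν : ν₁ / ν < 1 := (div_lt_one hν).2 hν₁ν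
  obtain ⟨T', hT'⟩ := eventually_atTop.1 ((hτ.tendsto.eventually_ge_atTop T₀).and
    (hσ.integral_delay.eventually_const_lt hνν))
  set T := max T' (T₀ + 1) with hT
  have hT₀T' : T₀ < T := (lt_add_one _).trans_le (le_max_right _ _)
  have hT₀T : T₀ ≤ T := hT₀T'.le
  have hT0 : 0 < T := hT₀0.trans_le hT₀T
  obtain ⟨z, hz, hzmin⟩ := (isCompact_Icc (a := T₀) (b := T)).exists_isMinOn
    (nonempty_Icc.2 hT₀T) (hx.cont.mono fun s hs => hT₀0.le.trans hs.1)
  have hz0 : 0 < x z := hx.pos z (hT₀0.le.trans hz.1)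
  obtain ⟨A, hA0, hA⟩ := exists_between (lt_min hz0 (lt_min hd0 hδ))
  obtain ⟨hAz, hA⟩ := lt_min_iff.1 hA
  obtain ⟨hAd, hAδ⟩ := lt_min_iff.1 hA
  have hu0 : ∀ t, 0 < A * Real.exp (-ν * S t) := fun t => mul_pos hA0 (Real.exp_pos _)
  have huA : ∀ t, 0 ≤ t → A * Real.exp (-ν * S t) ≤ A := fun t ht => by
    refine mul_le_of_le_one_right hA0.le (Real.exp_le_one_iff.2 ?_)
    have := mul_nonneg hν.le (hS0 t ht)
    linarith
  have hcomp := hx.lt_of_subsolution (u := fun t => A * Real.exp (-ν * S t)) (δ := δ) hb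
    hmono.monotoneOn hT₀0 hT₀T
    (fun t ht => ⟨(hT' t ((le_max_left _ _).trans ht)).1, (hτ.sub_mem (hT0.le.trans ht)).2⟩)
    (fun s hs => ((huA s (hT₀0.le.trans hs.1)).trans_lt hAz).trans_le (hzmin hs))
    (fun t _ => (hu0 t).le)
    (fun t ht => (hT₀' _ ((le_max_left _ _).trans (hT' t ((le_max_left _ _).trans ht)).1)).1.le) ?_
  · exact ⟨A, hA0, (eventually_ge_atTop T).mono fun t ht => (hcomp t ht).le⟩
  intro t ht
  have ht0 := hT0.trans_le ht
  obtain ⟨hd1, hd2⟩ := hT' t ((le_max_left _ _).trans ht)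
  have hd0' : 0 < t - τ t := hT₀0.trans_le hd1
  have hD := hσ.hasDerivAt_integral hτ hT₀0.le
    (fun s hs => (hT₀' s ((le_max_left _ _).trans hs)).2) (hT₀T'.trans_le ht)
  refine ⟨_, ((hD.const_mul (-ν)).exp).const_mul A, ?_⟩
  have h1 : k * (A * Real.exp (-ν * S t)) ≤ A * Real.exp (-ν * S (t - τ t)) := by
    rw [hk, mul_left_comm, ← Real.exp_add]
    refine mul_le_mul_of_nonneg_left (Real.exp_le_exp.2 ?_) hA0.le
    rw [← hσ.integral_sub hd0'.le ht0.le, div_lt_iff₀ hν] at hd2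
    simp only [hS]
    linarith
  have h2 : K * g (A * Real.exp (-ν * S t)) ≤ g (k * (A * Real.exp (-ν * S t))) :=
    hd ⟨hu0 t, (huA t ht0.le).trans_lt hAd⟩
  have h3 := (huA (t - τ t) hd0'.le).trans hAδ.le
  have h4 := h2.trans (hmono.monotoneOn ⟨(mul_pos hk0 (hu0 t)).le, h1.trans h3⟩
    ⟨(hu0 _).le, h3⟩ h1)
  have h5 : 0 < g (A * Real.exp (-ν * S t)) := hg.pos _ (hu0 t)
  have h6 : b * (K * g (A * Real.exp (-ν * S t))) ≤ b * g (A * Real.exp (-ν * S (t - τ t))) := by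
    gcongr
  have h7 : g (A * Real.exp (-ν * S t)) * a < g (A * Real.exp (-ν * S t)) * (K * b) := by gcongr
  have h8 : 0 < σ t := (hT₀' t ((le_max_left _ _).trans (hT₀T.trans ht))).2
  have h9 : A * (Real.exp (-ν * S t) * (-ν * (1 / σ t))) ≤ 0 := by
    have : 0 < A * Real.exp (-ν * S t) * (ν * (1 / σ t)) :=
      mul_pos (hu0 t) (mul_pos hν (one_div_pos.2 h8))
    linarith
  refine lt_of_le_of_lt h9 ?_
  linarith

/-- Upper estimate: for `ν < log (a / b) / β` a multiple of `u = exp (-ν ∫ 1 / σ)` is a supersolution,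
provided that `u' = -ν u / σ` is negligible against `g u`; the hypothesis `hsmall` ensures this because
`g u` is bounded below by a multiple of `u ^ γ`. -/
theorem DelayInequalities.le_exp {a b ν γ τbar : ℝ} {τ σ x : ℝ → ℝ} (hb : 0 < b)
    (hg : Nonlinearity g β) (hτ : Delay τ τbar) (hσ : Auxiliary τ σ τbar)
    (hx : DelayInequalities a b g τ x) (hx0 : Tendsto x atTop (𝓝 0)) (hν : 0 < ν)
    (hνab : b * Real.exp (β * ν) < a) (hγ : β < γ)
    (hsmall : Tendsto (fun t => Real.exp (ν * (γ - 1) * ∫ s in (0 : ℝ)..t, 1 / σ s) / σ t)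
      atTop (𝓝 0)) :
    ∃ C > 0, ∀ᶠ t in atTop, x t ≤ C * Real.exp (-ν * ∫ s in (0 : ℝ)..t, 1 / σ s) := by
  have hγ1 : 0 < γ - 1 := by linarith [hg.one_lt]
  obtain ⟨ν₁, hν₁, hν₁ν⟩ : ∃ ν₁, b * Real.exp (β * ν₁) < a ∧ ν < ν₁ := by
    have h1 : Tendsto (fun z => b * Real.exp (β * z)) (𝓝[>] ν) (𝓝 (b * Real.exp (β * ν))) :=
      ((by fun_prop : Continuous fun z => b * Real.exp (β * z)).tendsto ν).mono_left
        nhdsWithin_le_nhds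
    exact ((h1.eventually_lt_const hνab).and self_mem_nhdsWithin).exists
  set k := Real.exp ν₁ with hk
  have hk0 : 0 < k := Real.exp_pos _
  obtain ⟨K, hK1, hK2⟩ : ∃ K, k ^ β < K ∧ K < a / b :=
    exists_between (by rw [lt_div_iff₀ hb, hk, ← Real.exp_mul, mul_comm ν₁]; linarith)
  rw [lt_div_iff₀ hb] at hK2
  obtain ⟨δ, hδ, hmono⟩ := hg.exists_strictMonoOn
  obtain ⟨m, hm, hmg⟩ := hg.exists_rpow_le hγ
  obtain ⟨d, hd0, hd⟩ := mem_nhdsGT_iff_exists_Ioc_subset.1 ((hg.comp_mul_le hk0 hK1).and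
    (((tendsto_const_mul_nhdsGT_zero hk0).eventually (Ioo_mem_nhdsGT hδ)).and hmg))
  have hd0 : 0 < d := hd0
  set S : ℝ → ℝ := fun t => ∫ s in (0 : ℝ)..t, 1 / σ s with hS
  have hSmono : MonotoneOn S (Ici 0) := hσ.monotoneOn_integral hτ
  have hε : 0 < (a - K * b) * m / ν := div_pos (mul_pos (by linarith) hm) hν
  obtain ⟨T₀', hT₀'⟩ := eventually_atTop.1
    ((hx0.eventually_lt_const hd0).and (hσ.tendsto.eventually_gt_atTop 0))
  set T₀ := max T₀' 1 with hT₀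
  have hT₀0 : 0 < T₀ := lt_max_of_lt_right one_pos
  have hνν : 1 < ν₁ / ν := (one_lt_div hν).2 hν₁ν
  have hexp : Tendsto (fun t => Real.exp (ν * S t)) atTop atTop :=
    Real.tendsto_exp_atTop.comp (hσ.integral_atTop.const_mul_atTop hν)
  obtain ⟨T', hT'⟩ := eventually_atTop.1 ((hτ.tendsto.eventually_ge_atTop T₀).and
    ((hσ.integral_delay.eventually_lt_const hνν).and ((hsmall.eventually_lt_const hε).and
      (hexp.eventually_ge_atTop d⁻¹))))
  set T := max T' (T₀ + 1) with hT
  have hT₀T' : T₀ < T := (lt_add_one _).trans_le (le_max_right _ _)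
  have hT₀T : T₀ ≤ T := hT₀T'.le
  have hT0 : 0 < T := hT₀0.trans_le hT₀T
  -- This choice gives `u T = d`; moreover `C ≥ 1`, so that `u` is bounded below independently of `C`.
  set C := d * Real.exp (ν * S T) with hC
  have hC0 : 0 < C := mul_pos hd0 (Real.exp_pos _)
  have hC1 : 1 ≤ C := by
    have := (hT' T (le_max_left _ _)).2.2.2
    rwa [inv_le_iff_one_le_mul₀' hd0] at this
  have hu0 : ∀ t, 0 < C * Real.exp (-ν * S t) := fun t => mul_pos hC0 (Real.exp_pos _)
  have huT : C * Real.exp (-ν * S T) = d := by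
    rw [hC, mul_assoc, ← Real.exp_add, show ν * S T + -ν * S T = 0 by ring, Real.exp_zero, mul_one]
  have hanti : AntitoneOn (fun t => C * Real.exp (-ν * S t)) (Ici 0) := fun s hs t ht hst => by
    refine mul_le_mul_of_nonneg_left (Real.exp_le_exp.2 ?_) hC0.le
    have := mul_le_mul_of_nonneg_left (hSmono hs ht hst) hν.le
    linarith
  have hud : ∀ t, T ≤ t → C * Real.exp (-ν * S t) ∈ Ioc 0 d := fun t ht =>
    ⟨hu0 t, huT ▸ hanti (mem_Ici.2 hT0.le) (mem_Ici.2 (hT0.le.trans ht)) ht⟩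
  have hdelay : ∀ t, T ≤ t → C * Real.exp (-ν * S (t - τ t)) ≤ k * (C * Real.exp (-ν * S t)) := by
    intro t ht
    obtain ⟨hd1, hd2, -⟩ := hT' t ((le_max_left _ _).trans ht)
    rw [hk, mul_left_comm, ← Real.exp_add]
    refine mul_le_mul_of_nonneg_left (Real.exp_le_exp.2 ?_) hC0.le
    rw [← hσ.integral_sub (hT₀0.le.trans hd1) (hT0.le.trans ht), lt_div_iff₀ hν] at hd2
    simp only [hS]
    linarith
  have hcomp := hx.lt_of_supersolution (u := fun t => C * Real.exp (-ν * S t)) (δ := δ)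
    hmono.monotoneOn hT₀0 hT₀T (fun t ht => (hT' t ((le_max_left _ _).trans ht)).1) ?_
    (hanti.mono (Ici_subset_Ici.2 hT₀0.le))
    (fun t ht => (hdelay t ht).trans (hd (hud t ht)).2.1.2.le) ?_
  · exact ⟨C, hC0, (eventually_ge_atTop T).mono fun t ht => (hcomp t ht).le⟩
  · intro s hs
    refine (hT₀' s ((le_max_left _ _).trans hs.1)).1.trans_le ?_
    rw [← huT]
    exact hanti (mem_Ici.2 (hT₀0.le.trans hs.1)) (mem_Ici.2 hT0.le) hs.2
  intro t ht
  have ht0 := hT0.trans_le ht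
  have hD := hσ.hasDerivAt_integral hτ hT₀0.le
    (fun s hs => (hT₀' s ((le_max_left _ _).trans hs)).2) (hT₀T'.trans_le ht)
  refine ⟨_, ((hD.const_mul (-ν)).exp).const_mul C, ?_⟩
  obtain ⟨h1, h2, h3⟩ := hd (hud t ht)
  have h4 := (hmono.monotoneOn ⟨(hu0 _).le, (hdelay t ht).trans h2.2.le⟩
    (Ioo_subset_Icc_self h2) (hdelay t ht)).trans h1
  have h5 : 0 < σ t := (hT₀' t ((le_max_left _ _).trans (hT₀T.trans ht))).2
  have h6 := (hT' t ((le_max_left _ _).trans ht)).2.2.1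
  set u := C * Real.exp (-ν * S t) with hu
  have hut : 0 < u := hu0 t
  have h7 : Real.exp (-(ν * (γ - 1) * S t)) ≤ u ^ (γ - 1) := by
    have h8 : Real.exp (-ν * S t) ≤ u := le_mul_of_one_le_left (Real.exp_pos _).le hC1
    refine le_trans (le_of_eq ?_) (Real.rpow_le_rpow (Real.exp_pos _).le h8 hγ1.le)
    rw [← Real.exp_mul]
    congr 1
    ring
  have h8 : ν * (1 / σ t) < (a - K * b) * m * u ^ (γ - 1) := by
    have h9 : ν * (1 / σ t) < (a - K * b) * m * Real.exp (-(ν * (γ - 1) * S t)) := by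
      rw [Real.exp_neg, ← div_eq_mul_inv, lt_div_iff₀ (Real.exp_pos _)]
      rw [lt_div_iff₀ hν] at h6
      calc ν * (1 / σ t) * Real.exp (ν * (γ - 1) * S t)
          = Real.exp (ν * (γ - 1) * S t) / σ t * ν := by ring
        _ < _ := h6
    exact h9.trans_le (mul_le_mul_of_nonneg_left h7 (mul_pos (by linarith) hm).le)
  have h10 : u * (ν * (1 / σ t)) < (a - K * b) * g u := by
    calc u * (ν * (1 / σ t)) < u * ((a - K * b) * m * u ^ (γ - 1)) := mul_lt_mul_of_pos_left h8 hut
      _ = (a - K * b) * (m * u ^ γ) := by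
          rw [Real.rpow_sub_one hut.ne']
          field_simp
      _ ≤ _ := mul_le_mul_of_nonneg_left h3 (by linarith)
  have h11 : b * g (C * Real.exp (-ν * S (t - τ t))) ≤ b * (K * g u) := by gcongr
  have h12 : C * (Real.exp (-ν * S t) * (-ν * (1 / σ t))) = -(u * (ν * (1 / σ t))) := by
    rw [hu]; ring
  rw [h12]
  linarith

theorem Auxiliary.tendsto_exp_integral_div {τ σ : ℝ → ℝ} {τbar p m : ℝ} (hσ : Auxiliary τ σ τbar)
    (hτ : Delay τ τbar) (hp : 0 < p) (hle : ∀ᶠ s in atTop, p * s ≤ σ s) (hm0 : 0 < m)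
    (hm : m < p) :
    Tendsto (fun t => Real.exp (m * ∫ s in (0 : ℝ)..t, 1 / σ s) / σ t) atTop (𝓝 0) := by
  obtain ⟨T', hT'⟩ := eventually_atTop.1 hle
  set T := max T' 1 with hT
  have hT0 : 0 < T := lt_max_of_lt_right one_pos
  set B := Real.exp (m * (∫ s in (0 : ℝ)..T, 1 / σ s) - m * p⁻¹ * Real.log T) / p with hB
  have hlim : Tendsto (fun t : ℝ => B * t ^ (-(1 - m / p))) atTop (𝓝 0) := by
    have := (tendsto_rpow_neg_atTop (sub_pos.2 ((div_lt_one hp).2 hm))).const_mul B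
    rwa [mul_zero] at this
  refine squeeze_zero' ?_ ?_ hlim
  · filter_upwards [hσ.tendsto.eventually_gt_atTop 0] with t ht
    positivity
  · filter_upwards [eventually_ge_atTop T] with t ht
    have ht0 : 0 < t := hT0.trans_le ht
    have h1 := hσ.integral_le_log hτ hT0 hp (fun s hs => hT' s ((le_max_left _ _).trans hs))
      le_rfl ht
    rw [← hσ.integral_sub hT0.le ht0.le, Real.log_div ht0.ne' hT0.ne'] at h1
    have h2 : m * (∫ s in (0 : ℝ)..t, 1 / σ s) ≤
        m * (∫ s in (0 : ℝ)..T, 1 / σ s) - m * p⁻¹ * Real.log T + Real.log t * (m / p) := by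
      have := mul_le_mul_of_nonneg_left h1 hm0.le
      rw [div_eq_mul_inv m]
      linarith
    have h3 : p * t ≤ σ t := hT' t ((le_max_left _ _).trans ht)
    calc Real.exp (m * ∫ s in (0 : ℝ)..t, 1 / σ s) / σ t
        ≤ Real.exp (m * (∫ s in (0 : ℝ)..T, 1 / σ s) - m * p⁻¹ * Real.log T +
            Real.log t * (m / p)) / (p * t) := by gcongr
      _ = B * t ^ (-(1 - m / p)) := by
          rw [Real.exp_add, ← Real.rpow_def_of_pos ht0, hB, neg_sub, Real.rpow_sub_one ht0.ne']
          field_simp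

/-- If `σ t ≥ p t` with `p > (β - 1) / β * log (a / b)`, the solution decays like
`exp (-(log (a / b) / β) ∫ 1 / σ)` on the logarithmic scale. -/
theorem DelayInequalities.tendsto_log_div_integral {a b p τbar : ℝ} {τ σ x : ℝ → ℝ} (hb : 0 < b)
    (hab : b < a) (hg : Nonlinearity g β) (hτ : Delay τ τbar) (hσ : Auxiliary τ σ τbar)
    (hx : DelayInequalities a b g τ x) (hx0 : Tendsto x atTop (𝓝 0))
    (hp : (β - 1) / β * Real.log (a / b) < p) (hle : ∀ᶠ s in atTop, p * s ≤ σ s) :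
    Tendsto (fun t => Real.log (x t) / ∫ s in (0 : ℝ)..t, 1 / σ s) atTop
      (𝓝 (-(1 / β) * Real.log (a / b))) := by
  have hβ := hg.one_lt
  have hβ0 : 0 < β := by linarith
  have hL : 0 < Real.log (a / b) := Real.log_pos ((one_lt_div hb).2 hab)
  have hexpL : Real.exp (Real.log (a / b)) = a / b := Real.exp_log (div_pos (hb.trans hab) hb)
  have hp0 : 0 < p := lt_trans (mul_pos (div_pos (by linarith) hβ0) hL) hp
  have hdiv : ∀ C : ℝ, Tendsto (fun t => C / ∫ s in (0 : ℝ)..t, 1 / σ s) atTop (𝓝 0) := fun C =>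
    hσ.integral_atTop.const_div_atTop C
  refine tendsto_order.2 ⟨fun k hk => ?_, fun k hk => ?_⟩
  · obtain ⟨k', hk1, hk2⟩ := exists_between hk
    have hν : Real.log (a / b) / β < -k' := by
      rw [div_eq_mul_one_div]; linarith
    have hν0 : 0 < -k' := (div_pos hL hβ0).trans hν
    have h1 : a < b * Real.exp (β * -k') := by
      rw [← div_lt_iff₀' hb, ← hexpL, Real.exp_lt_exp]
      rwa [← div_lt_iff₀' hβ0]
    obtain ⟨A, hA, h2⟩ := hx.exp_le hb hg hτ hσ hx0 hν0 h1
    filter_upwards [h2, hσ.integral_atTop.eventually_gt_atTop 0,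
      (hdiv (Real.log A)).eventually_const_lt (sub_neg.2 hk1)] with t h3 h4 h5
    have h6 := Real.log_le_log (mul_pos hA (Real.exp_pos _)) h3
    rw [Real.log_mul hA.ne' (Real.exp_pos _).ne', Real.log_exp] at h6
    rw [lt_div_iff₀ h4] at h5 ⊢
    linarith
  · obtain ⟨k', hk1, hk2⟩ := exists_between (lt_min hk
      (show -(1 / β) * Real.log (a / b) < 0 from
        mul_neg_of_neg_of_pos (neg_neg_of_pos (one_div_pos.2 hβ0)) hL))
    obtain ⟨hk2, hk0⟩ := lt_min_iff.1 hk2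
    have hν : -k' < Real.log (a / b) / β := by
      rw [div_eq_mul_one_div]; linarith
    have hν0 : 0 < -k' := by linarith
    have h1 : b * Real.exp (β * -k') < a := by
      rw [← lt_div_iff₀' hb, ← hexpL, Real.exp_lt_exp]
      rwa [← lt_div_iff₀' hβ0]
    have h2 : β < p / -k' + 1 := by
      rw [← sub_lt_iff_lt_add, lt_div_iff₀ hν0]
      refine lt_trans ?_ hp
      rw [div_mul_eq_mul_div, mul_div_assoc]
      exact mul_lt_mul_of_pos_left hν (by linarith)
    obtain ⟨γ, hγ1, hγ2⟩ := exists_between h2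
    have h3 : -k' * (γ - 1) < p := by
      rw [← sub_lt_iff_lt_add, lt_div_iff₀ hν0] at hγ2
      linarith
    obtain ⟨C, hC, h4⟩ := hx.le_exp hb hg hτ hσ hx0 hν0 h1 hγ1
      (hσ.tendsto_exp_integral_div hτ hp0 hle (mul_pos hν0 (by linarith)) h3)
    filter_upwards [h4, hσ.integral_atTop.eventually_gt_atTop 0, eventually_ge_atTop 0,
      (hdiv (Real.log C)).eventually_lt_const (sub_pos.2 hk2)] with t h5 h6 ht h7
    have h8 := Real.log_le_log (hx.pos t ht) h5
    rw [Real.log_mul hC.ne' (Real.exp_pos _).ne', Real.log_exp] at h8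
    rw [div_lt_iff₀ h6] at h7 ⊢
    linarith

theorem Auxiliary.tendsto_integral_div_log {τ σ : ℝ → ℝ} {τbar l : ℝ} (hσ : Auxiliary τ σ τbar)
    (hτ : Delay τ τbar) (hl : 0 < l) (hlow : ∀ p, p < l → ∀ᶠ s in atTop, p * s ≤ σ s)
    (hup : ∀ p, l < p → ∀ᶠ s in atTop, σ s ≤ p * s) :
    Tendsto (fun t => (∫ s in (0 : ℝ)..t, 1 / σ s) / Real.log t) atTop (𝓝 (1 / l)) := by
  have hdiv : ∀ C : ℝ, Tendsto (fun t => C / Real.log t) atTop (𝓝 0) := fun C =>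
    Real.tendsto_log_atTop.const_div_atTop C
  refine tendsto_order.2 ⟨fun k hk => ?_, fun k hk => ?_⟩
  · obtain ⟨k', hk1, hk2⟩ := exists_between (max_lt hk (one_div_pos.2 hl))
    obtain ⟨hk1, hk0⟩ := max_lt_iff.1 hk1
    have h1 : l < k'⁻¹ := by rwa [one_div, lt_inv_comm₀ hk0 hl] at hk2
    obtain ⟨T', hT'⟩ := eventually_atTop.1 ((hup _ h1).and (hσ.tendsto.eventually_gt_atTop 0))
    set T := max T' 1 with hT
    have hT0 : 0 < T := lt_max_of_lt_right one_pos
    filter_upwards [eventually_ge_atTop T, eventually_gt_atTop 1, (hdiv ((∫ s in (0 : ℝ)..T, 1 / σ s)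
      - k' * Real.log T)).eventually_const_lt (sub_neg.2 hk1)] with t ht ht1 h2
    have ht0 : 0 < t := hT0.trans_le ht
    have h3 := hσ.log_le_integral hτ hT0 (fun s hs => (hT' s ((le_max_left _ _).trans hs)).2)
      (fun s hs => (hT' s ((le_max_left _ _).trans hs)).1) le_rfl ht
    rw [← hσ.integral_sub hT0.le ht0.le, Real.log_div ht0.ne' hT0.ne', inv_inv] at h3
    rw [lt_div_iff₀ (Real.log_pos ht1)] at h2 ⊢
    linarith
  · obtain ⟨k', hk1, hk2⟩ := exists_between hk
    have hk0 : 0 < k' := (one_div_pos.2 hl).trans hk1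
    have h1 : k'⁻¹ < l := by rwa [one_div, inv_lt_comm₀ hl hk0] at hk1
    obtain ⟨T', hT'⟩ := eventually_atTop.1 (hlow _ h1)
    set T := max T' 1 with hT
    have hT0 : 0 < T := lt_max_of_lt_right one_pos
    filter_upwards [eventually_ge_atTop T, eventually_gt_atTop 1, (hdiv ((∫ s in (0 : ℝ)..T, 1 / σ s)
      - k' * Real.log T)).eventually_lt_const (sub_pos.2 hk2)] with t ht ht1 h2
    have ht0 : 0 < t := hT0.trans_le ht
    have h3 := hσ.integral_le_log hτ hT0 (inv_pos.2 hk0)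
      (fun s hs => hT' s ((le_max_left _ _).trans hs)) le_rfl ht
    rw [← hσ.integral_sub hT0.le ht0.le, Real.log_div ht0.ne' hT0.ne', inv_inv] at h3
    rw [div_lt_iff₀ (Real.log_pos ht1)] at h2 ⊢
    linarith

/-! ### The four regimes -/

theorem eventually_mul_le {σ : ℝ → ℝ} {lam : ℝ≥0∞} {p : ℝ}
    (hlam : Tendsto (fun t => ENNReal.ofReal (σ t / t)) atTop (𝓝 lam))
    (hp : ENNReal.ofReal p < lam) : ∀ᶠ t in atTop, p * t ≤ σ t := by
  filter_upwards [hlam.eventually_const_lt hp, eventually_gt_atTop 0] with t h ht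
  exact (le_div_iff₀ ht).1 (ENNReal.ofReal_lt_ofReal_iff'.1 h).1.le

theorem eventually_le_mul {σ : ℝ → ℝ} {lam : ℝ≥0∞} {p : ℝ}
    (hlam : Tendsto (fun t => ENNReal.ofReal (σ t / t)) atTop (𝓝 lam))
    (hp : lam < ENNReal.ofReal p) : ∀ᶠ t in atTop, σ t ≤ p * t := by
  filter_upwards [hlam.eventually_lt_const hp, eventually_gt_atTop 0] with t h ht
  exact (div_le_iff₀ ht).1 (ENNReal.ofReal_lt_ofReal_iff'.1 h).1.le

theorem DelayInequalities.tendsto_div_Ginv_of_lt {a b τbar : ℝ} {τ σ x : ℝ → ℝ} {lam : ℝ≥0∞}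
    (hb : 0 < b) (hab : b < a) (hg : Nonlinearity g β) (hτ : Delay τ τbar)
    (hσ : Auxiliary τ σ τbar)
    (hlam : Tendsto (fun t => ENNReal.ofReal (σ t / t)) atTop (𝓝 lam))
    (hx : DelayInequalities a b g τ x) (hx0 : Tendsto x atTop (𝓝 0))
    (hlt : lam < ENNReal.ofReal ((β - 1) / β * Real.log (a / b))) :
    Tendsto (fun t => x t / Ginv g t) atTop
      (𝓝 ((a - b * Real.exp (lam.toReal * (β / (β - 1)))) ^ (-1 / (β - 1)))) := by
  have hβ1 : 0 < β - 1 := sub_pos.2 hg.one_lt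
  have hβ0 : 0 < β := by linarith
  have htop : lam ≠ ⊤ := hlt.ne_top
  have hl : 0 ≤ lam.toReal := ENNReal.toReal_nonneg
  have hlt' : lam.toReal < (β - 1) / β * Real.log (a / b) :=
    (ENNReal.lt_ofReal_iff_toReal_lt htop).1 hlt
  refine hx.tendsto_div_Ginv hb hg hτ hx0 (fun q hq => ?_) (fun q hq => ?_) hl ?_
  · obtain ⟨p, hp1, hp2⟩ := exists_between hq
    exact hσ.mul_le_sub_delay hτ (hl.trans_lt hp1) hp2
      (eventually_le_mul hlam ((ENNReal.lt_ofReal_iff_toReal_lt htop).2 hp1))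
  · rcases le_or_gt q 0 with h0 | h0
    · filter_upwards [eventually_ge_atTop 0] with t ht
      exact (hτ.sub_mem ht).2.trans
        (le_mul_of_one_le_left ht (Real.one_le_exp (by linarith)))
    · obtain ⟨p, hp1, hp2⟩ := exists_between hq
      exact hσ.sub_delay_le_mul hτ (h0.trans hp1) hp1 (eventually_mul_le hlam
        ((ENNReal.ofReal_lt_iff_lt_toReal (h0.trans hp1).le htop).2 hp2))
  · have h1 : lam.toReal * (β / (β - 1)) < Real.log (a / b) := by
      rw [← lt_div_iff₀ (div_pos hβ0 hβ1)]
      rwa [div_div_eq_mul_div, mul_comm, mul_div_right_comm]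
    rw [Real.lt_log_iff_exp_lt (div_pos (hb.trans hab) hb), lt_div_iff₀' hb] at h1
    linarith

theorem Lam_eq {a b l : ℝ} : Lam a b β (1 - Real.exp (-l)) =
    (a - b * Real.exp (l * (β / (β - 1)))) ^ (-1 / (β - 1)) := by
  rw [Lam, sub_sub_cancel, one_div, ← Real.exp_neg, neg_neg, ← Real.exp_mul]

theorem DelayInequalities.regimes {a b τbar : ℝ} {τ σ x : ℝ → ℝ} {lam : ℝ≥0∞}
    (hb : 0 < b) (hab : b < a) (hg : Nonlinearity g β) (hτ : Delay τ τbar)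
    (hσ : Auxiliary τ σ τbar)
    (hlam : Tendsto (fun t => ENNReal.ofReal (σ t / t)) atTop (𝓝 lam))
    (hx : DelayInequalities a b g τ x) (hx0 : Tendsto x atTop (𝓝 0)) :
    Regimes a b β g σ lam x := by
  have hβ1 : 0 < β - 1 := sub_pos.2 hg.one_lt
  have hcrit : 0 < (β - 1) / β * Real.log (a / b) :=
    mul_pos (div_pos hβ1 (by linarith)) (Real.log_pos ((one_lt_div hb).2 hab))
  refine ⟨fun h => ?_, fun _ h => ?_, fun h htop => ?_, fun h => ?_⟩
  · have := hx.tendsto_div_Ginv_of_lt hb hab hg hτ hσ hlam hx0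
      (h ▸ ENNReal.ofReal_pos.2 hcrit)
    simpa [h] using this
  · have h1 := hx.tendsto_div_Ginv_of_lt hb hab hg hτ hσ hlam hx0 h
    rw [← Lam_eq] at h1
    have h2 := (continuous_coe_real_ereal.tendsto _).comp h1
    have h3 : liminf (fun t => ((x t / Ginv g t : ℝ) : EReal)) atTop = _ := h2.liminf_eq
    have h4 : limsup (fun t => ((x t / Ginv g t : ℝ) : EReal)) atTop = _ := h2.limsup_eq
    rw [h3, h4]
    exact ⟨le_rfl, le_rfl, EReal.coe_lt_top _⟩
  · have hl := (ENNReal.ofReal_lt_iff_lt_toReal hcrit.le htop.ne).1 h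
    have hl0 := hcrit.trans hl
    obtain ⟨p, hp1, hp2⟩ := exists_between hl
    have hlow : ∀ p, p < lam.toReal → ∀ᶠ s in atTop, p * s ≤ σ s := fun p hp =>
      eventually_mul_le hlam (by
        rw [← ENNReal.ofReal_toReal htop.ne]
        exact (ENNReal.ofReal_lt_ofReal_iff hl0).2 hp)
    have hup : ∀ p, lam.toReal < p → ∀ᶠ s in atTop, σ s ≤ p * s := fun p hp =>
      eventually_le_mul hlam ((ENNReal.lt_ofReal_iff_toReal_lt htop.ne).2 hp)
    have h1 := (hx.tendsto_log_div_integral hb hab hg hτ hσ hx0 hp1 (hlow p hp2)).mul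
      (hσ.tendsto_integral_div_log hτ hl0 hlow hup)
    rw [mul_right_comm] at h1
    refine h1.congr' ?_
    filter_upwards [hσ.integral_atTop.eventually_gt_atTop 0] with t ht
    exact div_mul_div_cancel₀ ht.ne'
  · refine hx.tendsto_log_div_integral hb hab hg hτ hσ hx0 (lt_add_one _)
      (eventually_mul_le hlam ?_)
    rw [h]
    exact ENNReal.ofReal_lt_top

end DelayDecay

theorem mainTheorem5 (a b β τbar : ℝ) (g τ σ ψ : ℝ → ℝ) (lam : ℝ≥0∞)
    (hb : 0 < b) (hab : b < a)
    (hg : DelayDecay.Nonlinearity g β)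
    (hτ : DelayDecay.Delay τ τbar)
    (hσ : DelayDecay.Auxiliary τ σ τbar)
    (hlam : Tendsto (fun t => ENNReal.ofReal (σ t / t)) atTop (𝓝 lam))
    (hψ : DelayDecay.InitialFunction τbar ψ) :
    (∀ x : ℝ → ℝ, DelayDecay.SolvesDelay a b g τ τbar ψ x → Tendsto x atTop (𝓝 0) →
      DelayDecay.Regimes a b β g σ lam x) ∧
    (∀ x : ℝ → ℝ, DelayDecay.SolvesMax a b g τ τbar ψ x → Tendsto x atTop (𝓝 0) →
      DelayDecay.Regimes a b β g σ lam x) :=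
  ⟨fun _ hx hx0 => (hx.delayInequalities hb hg hτ hψ).regimes hb hab hg hτ hσ hlam hx0,
    fun _ hx hx0 => (hx.delayInequalities hb hg hτ hψ).regimes hb hab hg hτ hσ hlam hx0⟩
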